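/- **Trees.** Fix $n\ge 0$, $\gamma\in(0,1]$ and numbers $\alpha_1,\dots,\alpha_n\in(0,1]$ (the regularities attributed to the components $X^1,\dots,X^n$ of the path); put $\alpha_0=1$. Let $\mathcal{OF}$ be the real vector space spanned by ordered forests of planar rooted trees with vertices decorated by $\{0,\dots,n\}$; $|\omega|$ is the number of vertices of $\omega$. For a forest $\omega$ let $B_+(\omega)$ be the planar tree obtained by joining its trees, in order, to a new root. A set $c$ of edges is a *left admissible cut* if each path from the root to a leaf contains at most one edge of $c$ and if, with an edge $e$, all edges leaving the same vertex to the left of $e$ are in $c$. Let $\Delta_{MKW}(\omega)=\sum_c P^c\otimes B_-(T^c)$, summed over left admissible cuts $c$ of $B_+(\omega)$, where $T^c$ is the component of the root, $B_-$ deletes the root, and $P^c$ is the shuffle product of the forests cut off from the various vertices of $T^c$. Left grafting $\tau_1\rhd\tau_2$ of trees is the sum over all ways to attach $\tau_1$ to a vertex of $\tau_2$ by a new leftmost edge; it extends to forests on the right as a derivation and to forests on the left by $1\rhd\tau=\tau$, $(\tau_1\omega)\rhd\tau=\tau_1\rhd(\omega\rhd\tau)-(\tau_1\rhd\omega)\rhd\tau$.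 **Rough paths.** A *$\gamma$-regular planarly branched rough path* is a family $(\mathbb X_{st})_{s,t\in\mathbb R}$ of linear forms on $\mathcal{OF}$ with $\langle\mathbb X_{st},1\rangle=1$, multiplicative for the shuffle product, with $(\mathbb X_{su}\otimes\mathbb X_{ut})\Delta_{MKW}=\mathbb X_{st}$ for all $s,u,t$, and such that $|\langle\mathbb X_{st},\omega\rangle|/|t-s|^{\gamma|\omega|}$ is bounded over $s\ne t$ in every compact interval, for each forest $\omega$. Assume that $\mathbb X$ is time-augmented, $\langle\mathbb X_{st},\bullet_0\rangle=t-s$, and that $$\langle\mathbb X_{st},\omega\rhd\bullet_0\rangle=\int_s^t\langle\mathbb X_{su},\omega\rangle\,du\qquad\text{for all forests }\omega\text{ and all }s,t.$$ **Algebra.** Let $\mathcal{PB}$ be spanned by the planar rooted trees with edges decorated by $\{0,\dots,n\}$ ($0$ meaning undecorated) in which every decorated edge leads to a leaf and is the rightmost edge leaving its vertex. Let $\varphi$ be the bijection from vertex-decorated planar trees to the basis trees of $\mathcal{PB}$ that replaces each vertex with decoration $i\ne0$ by two vertices joined by a rightmost edge with decoration $i$; it is applied to forests tree by tree. The degree of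 a tree in $\mathcal{PB}$ is the sum over its edges of $1$ for an undecorated edge and $\alpha_i-1$ for an edge decorated by $i\neq 0$; $\mathcal{PB}_a$ is the span of the trees of degree $a$. Let $$A=\Big\{\sum_{i=0}^nk_i\alpha_i:\ k_i\in\mathbb N\Big\}\cup\Big\{\sum_{i=0}^nk_i\alpha_i-1:\ k_i\in\mathbb N\Big\}.$$ Let $\mathcal{PB}_+\subset\mathcal{PB}$ be spanned by the trees $B_+(\varphi(\omega))$, $\omega$ a forest (those with no decorated edge at the root), with the tree product (join the roots and shuffle the branches) and unit the one-vertex tree $\bullet$. Define $\Delta^+:\mathcal{PB}\to\mathcal{PB}_+\otimes\mathcal{PB}$ by $\Delta^+(B_+(\varphi(\omega)))=(B_+\varphi\otimes B_+\varphi)\Delta_{MKW}(\omega)$ and, for a tree $\tau$ with a decorated edge at the root, $\Delta^+(\tau)=(\mathrm{id}\otimes B_-)(\Delta^+(B_+(\tau))-B_+(\tau)\otimes\bullet)$. Let $\mathcal G$ be the set of all $\Gamma_g=(g\otimes\mathrm{id})\Delta^+$ with $g$ a character (unital multiplicative linear form) of $\mathcal{PB}_+$. **Maps.** Let $\gamma_{st}$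 be the linear form on $\mathcal{PB}_+$ with $\gamma_{st}(B_+(\varphi(\omega)))=\langle\mathbb X_{st},\omega\rangle$, and put $\Gamma_{st}=(\gamma_{ts}\otimes\mathrm{id})\Delta^+$. Let $\Pi_s$ be the linear map from $\mathcal{PB}$ to distributions on $\mathbb R$ for which $\Pi_s(B_+(\varphi(\omega)))$ is the function $t\mapsto\langle\mathbb X_{st},\omega\rangle$, and $\Pi_s(\tau)=\frac{d}{dt}\Pi_s(B_+(\tau))$, as a distributional derivative, for a tree $\tau$ with a decorated edge at the root. **Theorem.** 1. $A$ contains $0$, is bounded below and locally finite; $\mathcal{PB}=\bigoplus_{a\in A}\mathcal{PB}_a$ with every $\mathcal{PB}_a$ a Banach space (in the $\ell^1$-norm of its basis of trees) and $0\ne\bullet\in\mathcal{PB}_0$; $\mathcal G$ is a group of linear operators with $\Gamma v-v\in\bigoplus_{b<a}\mathcal{PB}_b$ for $\Gamma\in\mathcal G$, $v\in\mathcal{PB}_a$, $a\in A$. Moreover $(A,\mathcal{PB},\mathcal G)$ is a regularity structure, i.e. in addition $\mathcal{PB}_0=\mathbb R\bullet$, if and only if $\sum_{i=1}^nk_i\alpha_i\ne1$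 for all $k_1,\dots,k_n\in\mathbb N$. 2. There is exactly one $\Pi$ with values in $\mathcal D'(\mathbb R)$ as described, and $(\Pi,\Gamma)$ is a model for $(A,\mathcal{PB},\mathcal G)$ with values in $\mathcal D'(\mathbb R)$: $\Gamma_{xy}\in\mathcal G$, $\Gamma_{xx}=\mathrm{id}$, $\Gamma_{xy}\Gamma_{yz}=\Gamma_{xz}$, each $\Pi_x$ is linear and continuous on every $\mathcal{PB}_a$, and $\Pi_y=\Pi_x\Gamma_{xy}$, for all $x,y,z\in\mathbb R$. 3. If every function $t\mapsto\langle\mathbb X_{st},\omega\rangle$ grows at most polynomially, the same holds with the space $\mathcal S'(\mathbb R)$ of tempered distributions in place of $\mathcal D'(\mathbb R)$. -/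

import Mathlib

open scoped TensorProduct Distributions SchwartzMap

/-! ### Planar rooted trees and ordered forests -/

/-- Planar rooted trees with vertices decorated by `{0, …, n}`: a root decoration together with the
list of branches, from left to right.  An ordered forest is a `List (VTree n)`. -/
inductive VTree (n : ℕ) : Type
  | node : Fin (n + 1) → List (VTree n) → VTree n

/-- Planar rooted trees with edges decorated by `{0, …, n}`: the list, from left to right, of the
edges leaving the root, each with its decoration and the subtree it leads to.  The decoration `0`
stands for an undecorated edge. -/
inductive ETree (n : ℕ) : Type
  | node : List (Fin (n + 1) × ETree n) → ETree n

/-- The space spanned by ordered forests of planar trees with decorated vertices. -/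
abbrev OF (n : ℕ) : Type := List (VTree n) →₀ ℝ

namespace VTree
variable {n : ℕ}

mutual
/-- The number of vertices of a tree. -/
def size : VTree n → ℕ
  | node _ ts => sizeList ts + 1
/-- The number of vertices of a forest. -/
def sizeList : List (VTree n) → ℕ
  | [] => 0
  | t :: ts => size t + sizeList ts
end

mutual
/-- The trees obtained by attaching `s` to some vertex of a tree by a new leftmost edge. -/
def graftTree (s : VTree n) : VTree n → List (VTree n)
  | node c ts => node c (s :: ts) :: (graftTreeForest s ts).map (node c)
/-- The forests obtained by attaching `s` to some vertex of a forest by a new leftmost edge. -/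
def graftTreeForest (s : VTree n) : List (VTree n) → List (List (VTree n))
  | [] => []
  | t :: ts => (graftTree s t).map (· :: ts) ++ (graftTreeForest s ts).map (t :: ·)
end

/-- Left grafting of a single tree, extended as a derivation to ordered forests. -/
noncomputable def graftLeft (s : VTree n) : OF n →ₗ[ℝ] OF n :=
  Finsupp.linearCombination ℝ fun w =>
    ((graftTreeForest s w).map fun w' => Finsupp.single w' (1 : ℝ)).sum

/-- Auxiliary recursion for `graft`; the first argument bounds the number of trees of the forest. -/
noncomputable def graftAux : ℕ → List (VTree n) → VTree n → OF n
  | _, [], t => Finsupp.single [t] 1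
  | 0, _ :: _, _ => 0
  | k + 1, s :: w, t =>
      graftLeft s (graftAux k w t) - ((graftTreeForest s w).map fun w' => graftAux k w' t).sum

/-- The Guin--Oudom extension `w ⊳ t` of left grafting to an ordered forest `w` and a tree `t`:
`1 ⊳ t = t` and `(s w) ⊳ t = s ⊳ (w ⊳ t) - (s ⊳ w) ⊳ t`. -/
noncomputable def graft (w : List (VTree n)) (t : VTree n) : OF n := graftAux w.length w t

mutual
/-- The left admissible cuts of a tree.  A cut is recorded as the list of the forests cut off from
the vertices of the trunk, together with the trunk. -/
def treeCuts : VTree n → List (List (List (VTree n)) × VTree n)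
  | node c ts => (prefixCuts [] ts).map fun p => (p.1, node c p.2)
/-- The left admissible cuts at a vertex with branches `pre ++ ts` for which all the edges to
`pre` are cut: the set of cut edges at a vertex is closed under passing to the left, so it is an
initial segment, and inside a branch that was cut off nothing else is cut. -/
def prefixCuts (pre : List (VTree n)) :
    List (VTree n) → List (List (List (VTree n)) × List (VTree n))
  | [] => [([pre], [])]
  | t :: ts =>
      ((treeCuts t).flatMap fun p => (keepCuts ts).map fun q =>
        (pre :: (p.1 ++ q.1), p.2 :: q.2)) ++ prefixCuts (pre ++ [t]) ts
/-- The left admissible cuts inside the branches `ts` of a vertex for which none of the edges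
to `ts` is cut. -/
def keepCuts : List (VTree n) → List (List (List (VTree n)) × List (VTree n))
  | [] => [([], [])]
  | t :: ts => (treeCuts t).flatMap fun p => (keepCuts ts).map fun q => (p.1 ++ q.1, p.2 :: q.2)
end

/-- The left admissible cuts `c` of `B₊(w)`: the list of the forests making up the pruned part
(one for each vertex of the trunk) and the forest obtained from the trunk by deleting the root. -/
def forestCuts (w : List (VTree n)) : List (List (List (VTree n)) × List (VTree n)) :=
  prefixCuts [] w

theorem graftTreeForest_length (s : VTree n) (w w' : List (VTree n))
    (h : w' ∈ graftTreeForest s w) : w'.length = w.length := by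
  induction w generalizing w' with
  | nil => simp [graftTreeForest] at h
  | cons t ts ih =>
    simp only [graftTreeForest, List.mem_append, List.mem_map] at h
    rcases h with ⟨a, _, rfl⟩ | ⟨a, ha, rfl⟩
    · simp
    · simp [ih a ha]

/-- Grafting an ordered forest onto a single vertex attaches its trees in the given order. -/
theorem graft_vertex (w : List (VTree n)) (c : Fin (n + 1)) :
    graft w (node c []) = Finsupp.single [node c w] 1 := by
  suffices H : ∀ (k : ℕ) (w : List (VTree n)), w.length = k →
      graftAux k w (node c []) = Finsupp.single [node c w] 1 from H _ w rfl
  intro k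
  induction k with
  | zero =>
    intro w hw
    obtain rfl := List.length_eq_zero_iff.1 hw
    rfl
  | succ k ih =>
    intro w hw
    cases w with
    | nil => simp at hw
    | cons s w =>
      have hk : w.length = k := by simpa using hw
      have hmap : ((graftTreeForest s w).map fun w' => graftAux k w' (node c [])) =
          (graftTreeForest s w).map fun w' => Finsupp.single [node c w'] (1 : ℝ) := by
        apply List.map_congr_left
        intro w' hw'
        exact ih w' ((graftTreeForest_length s w w' hw').trans hk)
      simp [graftAux, hmap, ih w hk, graftLeft, graftTreeForest, graftTree, Function.comp_def]

end VTree

/-! ### Shuffles and the Munthe-Kaas--Wright coproduct -/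

section Shuffle
variable {β : Type*}

/-- All shuffles of two words, listed with multiplicity. -/
def shuffles : List β → List β → List (List β)
  | [], w => [w]
  | a :: v, [] => [a :: v]
  | a :: v, b :: w => (shuffles v (b :: w)).map (a :: ·) ++ (shuffles (a :: v) w).map (b :: ·)
termination_by v w => v.length + w.length

/-- All shuffles of a list of words, listed with multiplicity. -/
def shuffleAll : List (List β) → List (List β)
  | [] => [[]]
  | w :: ws => (shuffleAll ws).flatMap (shuffles w)

/-- The formal sum of a list of basis elements. -/
noncomputable def listSum {ι : Type*} (l : List ι) : ι →₀ ℝ :=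
  (l.map fun i => Finsupp.single i (1 : ℝ)).sum

/-- The bilinear shuffle product on the space spanned by words. -/
noncomputable def shuffleProd : (List β →₀ ℝ) →ₗ[ℝ] (List β →₀ ℝ) →ₗ[ℝ] (List β →₀ ℝ) :=
  Finsupp.linearCombination ℝ fun v =>
    Finsupp.linearCombination ℝ fun w => listSum (shuffles v w)

end Shuffle

/-- The Munthe-Kaas--Wright coproduct: the sum over the left admissible cuts of `B₊(w)` of the
pruned part (the shuffle product of the forests cut off from the different vertices) tensor the
trunk without its root. -/
noncomputable def mkwCoproduct (n : ℕ) : OF n →ₗ[ℝ] OF n ⊗[ℝ] OF n :=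
  Finsupp.linearCombination ℝ fun w =>
    ((VTree.forestCuts w).map fun c =>
      listSum (shuffleAll c.1) ⊗ₜ[ℝ] Finsupp.single c.2 (1 : ℝ)).sum

/-! ### Planarly branched rough paths -/

/-- A `γ`-regular planarly branched rough path: a two-parameter family of characters of the
Munthe-Kaas--Wright Hopf algebra satisfying Chen's identity and the Hölder bounds
`|⟨X_st, w⟩| ≲ |t - s| ^ (γ |w|)`, uniformly on compact time intervals. -/
structure PlanarRoughPath (n : ℕ) (γ : ℝ) where
  X : ℝ → ℝ → OF n →ₗ[ℝ] ℝ
  map_one : ∀ s t, X s t (Finsupp.single [] 1) = 1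
  map_shuffle : ∀ s t x y, X s t (shuffleProd x y) = X s t x * X s t y
  chen : ∀ s u t x,
    LinearMap.mul' ℝ ℝ (TensorProduct.map (X s u) (X u t) (mkwCoproduct n x)) = X s t x
  bound : ∀ (w : List (VTree n)) (K : ℝ), ∃ C : ℝ, ∀ s ∈ Set.Icc (-K) K, ∀ t ∈ Set.Icc (-K) K,
    s ≠ t → |X s t (Finsupp.single w 1)| / |t - s| ^ (γ * (VTree.sizeList w : ℝ)) ≤ C

namespace PlanarRoughPath
variable {n : ℕ} {γ : ℝ}

/-- The first component of the path is time. -/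
def IsTimeAugmented (X : PlanarRoughPath n γ) : Prop :=
  ∀ s t, X.X s t (Finsupp.single [VTree.node 0 []] 1) = t - s

/-- `⟨X_st, w ⊳ •₀⟩ = ∫_s^t ⟨X_su, w⟩ du` for all ordered forests `w`. -/
def EdgesAreIntegration (X : PlanarRoughPath n γ) : Prop :=
  ∀ s t (w : List (VTree n)), X.X s t (VTree.graft w (VTree.node 0 [])) =
    ∫ u in s..t, X.X s u (Finsupp.single w 1)

/-- The components `t ↦ ⟨X_st, w⟩` grow at most polynomially. -/
def HasPolynomialGrowth (X : PlanarRoughPath n γ) : Prop :=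
  ∀ s (w : List (VTree n)), ∃ (C : ℝ) (N : ℕ), ∀ t,
    |X.X s t (Finsupp.single w 1)| ≤ C * (1 + |t|) ^ N

end PlanarRoughPath

/-! ### Edge-decorated trees -/

namespace ETree
variable {n : ℕ}

/-- The edges leaving the root, with the subtrees they lead to. -/
def branches : ETree n → List (Fin (n + 1) × ETree n)
  | node bs => bs

/-- The contribution of an edge to the degree: `1` for an undecorated edge and `α i - 1` for an
edge with decoration `i ≠ 0`. -/
noncomputable def edgeDeg (α : Fin n → ℝ) : Fin (n + 1) → ℝ := Fin.cases 1 fun i => α i - 1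

mutual
/-- The degree of a tree, the sum of the contributions of its edges. -/
noncomputable def deg (α : Fin n → ℝ) : ETree n → ℝ
  | node bs => degList α bs
/-- The sum of the contributions of all the edges in a list of branches. -/
noncomputable def degList (α : Fin n → ℝ) : List (Fin (n + 1) × ETree n) → ℝ
  | [] => 0
  | (d, t) :: bs => edgeDeg α d + deg α t + degList α bs
end

/-- The trees that span `PB`: every decorated edge leads to a leaf and is the rightmost edge at the
vertex it leaves (so each vertex has at most one outgoing decorated edge). -/
inductive IsPB : ETree n → Prop
  | node (bs : List (Fin (n + 1) × ETree n)) :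
      (∀ p ∈ bs, IsPB p.2) → (∀ p ∈ bs, p.1 ≠ 0 → p.2 = ETree.node []) →
      (∀ p ∈ bs.dropLast, p.1 = 0) → IsPB (ETree.node bs)

mutual
/-- Replace every vertex with a decoration `i ≠ 0` by two vertices connected by a rightmost edge
with decoration `i`, all the other edges being undecorated. -/
def ofV : VTree n → ETree n
  | .node c ts => .node (ofVList ts ++ if c = 0 then [] else [(c, .node [])])
/-- The undecorated branches corresponding to a forest. -/
def ofVList : List (VTree n) → List (Fin (n + 1) × ETree n)
  | [] => []
  | t :: ts => (0, ofV t) :: ofVList ts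
end

mutual
/-- Contract every decorated edge and move its decoration to the vertex it leaves. -/
def toV : ETree n → VTree n
  | .node bs => .node ((bs.getLast?.map Prod.fst).getD 0) (toVList bs)
/-- The forest corresponding to the undecorated branches in a list. -/
def toVList : List (Fin (n + 1) × ETree n) → List (VTree n)
  | [] => []
  | (d, t) :: bs => if d = 0 then toV t :: toVList bs else toVList bs
end

theorem toVList_append_decorated (bs : List (Fin (n + 1) × ETree n)) (c : Fin (n + 1)) (h : c ≠ 0)
    (t : ETree n) : toVList (bs ++ [(c, t)]) = toVList bs := by
  induction bs with
  | nil => simp [toVList, h]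
  | cons p bs ih => obtain ⟨d, s⟩ := p; simp [toVList, ih]

theorem ofVList_fst (ts : List (VTree n)) : ∀ p ∈ ofVList ts, p.1 = 0 := by
  induction ts with
  | nil => simp [ofVList]
  | cons t ts ih =>
    intro p hp
    simp only [ofVList, List.mem_cons] at hp
    rcases hp with rfl | hp
    · rfl
    · exact ih p hp

theorem ofVList_root (ts : List (VTree n)) :
    ((ofVList ts).getLast?.map Prod.fst).getD 0 = 0 := by
  cases h : (ofVList ts).getLast? with
  | none => rfl
  | some p => simpa using ofVList_fst ts p (List.mem_of_getLast? h)

mutual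
theorem toV_ofV : ∀ v : VTree n, toV (ofV v) = v
  | .node c ts => by
    by_cases h : c = 0
    · subst h
      simp only [ofV, if_true, List.append_nil, toV, ofVList_root, toVList_ofVList ts]
    · simp only [ofV, h, if_false, toV, toVList_append_decorated _ c h, toVList_ofVList ts]
      simp
theorem toVList_ofVList : ∀ ts : List (VTree n), toVList (ofVList ts) = ts
  | [] => rfl
  | t :: ts => by simp [ofVList, toVList, toV_ofV t, toVList_ofVList ts]
end

theorem isPB_leaf : IsPB (ETree.node [] : ETree n) :=
  .node _ (by simp) (by simp) (by simp)

mutual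
theorem isPB_ofV : ∀ v : VTree n, IsPB (ofV v)
  | .node c ts => by
    have h1 := isPB_ofVList ts
    have h2 := ofVList_fst ts
    by_cases h : c = 0
    · simp only [ofV, h, if_true, List.append_nil]
      exact .node _ h1 (fun p hp hne => absurd (h2 p hp) hne)
        (fun p hp => h2 p (List.mem_of_mem_dropLast hp))
    · simp only [ofV, h, if_false]
      refine .node _ ?_ ?_ ?_
      · intro p hp
        rcases List.mem_append.1 hp with hp | hp
        · exact h1 p hp
        · simp only [List.mem_singleton] at hp
          subst hp
          exact isPB_leaf
      · intro p hp hne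
        rcases List.mem_append.1 hp with hp | hp
        · exact absurd (h2 p hp) hne
        · simp only [List.mem_singleton] at hp
          subst hp
          rfl
      · intro p hp
        rw [List.dropLast_concat] at hp
        exact h2 p hp
theorem isPB_ofVList : ∀ ts : List (VTree n), ∀ p ∈ ofVList ts, IsPB p.2
  | [] => by simp [ofVList]
  | t :: ts => by
    intro p hp
    simp only [ofVList, List.mem_cons] at hp
    rcases hp with rfl | hp
    · exact isPB_ofV t
    · exact isPB_ofVList ts p hp
end

theorem ofVList_toVList (bs : List (Fin (n + 1) × ETree n))
    (h0 : ∀ p ∈ bs, p.1 = 0) (h : ∀ p ∈ bs, ofV (toV p.2) = p.2) :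
    ofVList (toVList bs) = bs := by
  induction bs with
  | nil => rfl
  | cons p bs ih =>
    obtain ⟨d, t⟩ := p
    have hd : d = 0 := h0 (d, t) (by simp)
    have ht : ofV (toV t) = t := h (d, t) (by simp)
    have hb := ih (fun p hp => h0 p (by simp [hp])) (fun p hp => h p (by simp [hp]))
    simp [toVList, ofVList, hd, ht, hb]

theorem ofV_toV (t : ETree n) (ht : IsPB t) : ofV (toV t) = t := by
  induction ht with
  | node bs h1 h2 h3 ih =>
    rcases List.eq_nil_or_concat bs with rfl | ⟨cs, p, rfl⟩
    · simp [toV, ofV, toVList, ofVList]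
    · obtain ⟨d, s⟩ := p
      rw [List.concat_eq_append] at *
      rw [List.dropLast_concat] at h3
      by_cases hd : d = 0
      · have h0 : ∀ p ∈ cs ++ [(d, s)], p.1 = 0 := by
          intro p hp
          rcases List.mem_append.1 hp with hp | hp
          · exact h3 p hp
          · simp only [List.mem_singleton] at hp
            subst hp
            exact hd
        have hc := ofVList_toVList _ h0 ih
        subst hd
        simp [toV, ofV, hc]
      · have hs : s = ETree.node [] := h2 (d, s) (by simp) hd
        have hc := ofVList_toVList cs h3 (fun p hp => ih p (by simp [hp]))
        simp [toV, ofV, toVList_append_decorated _ d hd, hd, hs, hc]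

end ETree

/-- The basis trees of `PB`. -/
abbrev PBTree (n : ℕ) : Type := {t : ETree n // t.IsPB}

/-- The vector space `PB` spanned by planar trees with decorated edges. -/
abbrev PB (n : ℕ) : Type := PBTree n →₀ ℝ

/-- The ordered forests of trees in `PB`. -/
abbrev OB (n : ℕ) : Type := List (PBTree n) →₀ ℝ

/-- The bijection `φ` between planar trees with decorated vertices and planar trees with decorated
edges. -/
def phi {n : ℕ} : VTree n ≃ PBTree n where
  toFun v := ⟨ETree.ofV v, ETree.isPB_ofV v⟩
  invFun t := t.1.toV
  left_inv := ETree.toV_ofV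
  right_inv t := Subtype.ext (ETree.ofV_toV t.1 t.2)

namespace PBTree
variable {n : ℕ}

/-- The degree of a tree. -/
noncomputable def deg (α : Fin n → ℝ) (t : PBTree n) : ℝ := t.1.deg α

/-- Some edge adjacent to the root is decorated. -/
def HasDecoratedRoot (t : PBTree n) : Prop := ∃ p ∈ t.1.branches, p.1 ≠ 0

/-- `B₊`: join the trees of a forest to a new root by undecorated edges, in the given order. -/
def bPlus (w : List (PBTree n)) : PBTree n :=
  ⟨.node (w.map fun t => (0, t.1)), .node _
    (by
      intro p hp
      obtain ⟨t, _, rfl⟩ := List.mem_map.1 hp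
      exact t.2)
    (by
      intro p hp hne
      obtain ⟨t, _, rfl⟩ := List.mem_map.1 hp
      exact absurd rfl hne)
    (by
      intro p hp
      obtain ⟨t, _, rfl⟩ := List.mem_map.1 (List.mem_of_mem_dropLast hp)
      rfl)⟩

/-- The tree with one vertex. -/
def bullet : PBTree n := bPlus []

theorem isPB_of_mem_branches (t : PBTree n) (p : Fin (n + 1) × ETree n)
    (hp : p ∈ t.1.branches) : p.2.IsPB := by
  obtain ⟨t, ht⟩ := t
  cases ht with
  | node bs h1 _ _ => exact h1 p hp

/-- `B₋`: delete the root (used for trees whose root edges are undecorated). -/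
def bMinus (t : PBTree n) : List (PBTree n) :=
  t.1.branches.attach.map fun p => ⟨p.1.2, t.isPB_of_mem_branches p.1 p.2⟩

theorem bMinus_bPlus (w : List (PBTree n)) : bMinus (bPlus w) = w := by
  apply List.map_injective_iff.2 (Subtype.val_injective (p := fun t : ETree n => t.IsPB))
  simp only [bMinus, List.map_map]
  change (List.map (fun p : {x // x ∈ (bPlus w).1.branches} => p.1.2) _) = _
  rw [List.attach_map_val (f := fun q : Fin (n + 1) × ETree n => q.2)]
  simp [bPlus, ETree.branches]

theorem not_hasDecoratedRoot_bPlus (w : List (PBTree n)) : ¬ (bPlus w).HasDecoratedRoot := by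
  rintro ⟨p, hp, hne⟩
  obtain ⟨t, _, rfl⟩ := List.mem_map.1 hp
  exact hne rfl

theorem bPlus_bMinus (t : PBTree n) (h : ¬ t.HasDecoratedRoot) : bPlus (bMinus t) = t := by
  obtain ⟨⟨bs⟩, ht⟩ := t
  apply Subtype.ext
  have h0 : ∀ p ∈ bs, ((0 : Fin (n + 1)), p.2) = p := by
    intro p hp
    have : p.1 = 0 := by
      by_contra hne
      exact h ⟨p, hp, hne⟩
    exact Prod.ext this.symm rfl
  have key : (bs.attach.map fun p => ((0 : Fin (n + 1)), p.1.2)) = bs := by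
    rw [List.attach_map_val (f := fun q : Fin (n + 1) × ETree n => ((0 : Fin (n + 1)), q.2))]
    conv_rhs => rw [← List.map_id bs]
    exact List.map_congr_left h0
  have step : (bPlus (bMinus ⟨.node bs, ht⟩)).1 =
      .node (bs.attach.map fun p => ((0 : Fin (n + 1)), p.1.2)) := by
    simp only [bPlus, bMinus, List.map_map]
    rfl
  rw [step, key]

end PBTree

/-! ### The coaction and the structure group -/

/-- The basis trees of `PB₊`: no decorated edge is adjacent to the root.  These are the trees
`B₊(φ(w))` for ordered forests `w`; the unit is the tree with one vertex, and all the others have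
positive degree. -/
abbrev PlusTree (n : ℕ) : Type := {t : PBTree n // ¬ t.HasDecoratedRoot}

/-- The space `PB₊`. -/
abbrev PBPlus (n : ℕ) : Type := PlusTree n →₀ ℝ

namespace PlusTree
variable {n : ℕ}

/-- `B₊` as a map to the basis trees of `PB₊`. -/
def bPlus (w : List (PBTree n)) : PlusTree n :=
  ⟨PBTree.bPlus w, PBTree.not_hasDecoratedRoot_bPlus w⟩

/-- The tree with one vertex, the unit of `PB₊`. -/
def bullet : PlusTree n := bPlus []

/-- The tree product on `PB₊`: join the roots and shuffle the branches. -/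
noncomputable def treeProd : PBPlus n →ₗ[ℝ] PBPlus n →ₗ[ℝ] PBPlus n :=
  Finsupp.linearCombination ℝ fun a => Finsupp.linearCombination ℝ fun b =>
    listSum ((shuffles (PBTree.bMinus a.1) (PBTree.bMinus b.1)).map bPlus)

end PlusTree

section Coaction
variable (n : ℕ)

/-- `B₊ ∘ φ : OF → PB`. -/
noncomputable def bPlusPhi : OF n →ₗ[ℝ] PB n :=
  Finsupp.lmapDomain ℝ ℝ fun w => PBTree.bPlus (w.map phi)

/-- `B₊ ∘ φ : OF → PB₊`. -/
noncomputable def bPlusPhiPlus : OF n →ₗ[ℝ] PBPlus n :=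
  Finsupp.lmapDomain ℝ ℝ fun w => PlusTree.bPlus (w.map phi)

/-- The inverse `PB₊ → OF` of `B₊ ∘ φ`. -/
noncomputable def phiInvBMinus : PBPlus n →ₗ[ℝ] OF n :=
  Finsupp.lmapDomain ℝ ℝ fun t => (PBTree.bMinus t.1).map phi.symm

open Classical in
/-- `B₋` from the trees in `PB` without decorated root edges to ordered forests; a tree with a
decorated root edge, on which `B₋` is not defined, is sent to `0`. -/
noncomputable def bMinusForest : PB n →ₗ[ℝ] OB n :=
  Finsupp.linearCombination ℝ fun t =>
    if t.HasDecoratedRoot then 0 else Finsupp.single (PBTree.bMinus t) 1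

/-- The identification of one-tree forests with trees; all other forests are sent to `0`. -/
noncomputable def forestToTree : OB n →ₗ[ℝ] PB n :=
  Finsupp.linearCombination ℝ fun w => match w with
    | [t] => Finsupp.single t 1
    | _ => 0

/-- `B₋` as a map to `PB`, for trees whose root has exactly one, undecorated, edge. -/
noncomputable def bMinusTree : PB n →ₗ[ℝ] PB n := forestToTree n ∘ₗ bMinusForest n

/-- `Δ⁺` on a tree without decorated root edges:
`Δ⁺(B₊(φ(w))) = (B₊ ∘ φ ⊗ B₊ ∘ φ) Δ_MKW(w)`. -/
noncomputable def deltaPlusPlain (t : PBTree n) : PBPlus n ⊗[ℝ] PB n :=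
  TensorProduct.map (bPlusPhiPlus n) (bPlusPhi n)
    (mkwCoproduct n (Finsupp.single ((PBTree.bMinus t).map phi.symm) 1))

open Classical in
/-- The coaction `Δ⁺ : PB → PB₊ ⊗ PB`.  On a tree `t` with a decorated root edge,
`Δ⁺(t) = (id ⊗ B₋)(Δ⁺(B₊(t)) - B₊(t) ⊗ •)`. -/
noncomputable def deltaPlus : PB n →ₗ[ℝ] PBPlus n ⊗[ℝ] PB n :=
  Finsupp.linearCombination ℝ fun t =>
    if t.HasDecoratedRoot then
      TensorProduct.map LinearMap.id (bMinusTree n)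
        (deltaPlusPlain n (PBTree.bPlus [t]) -
          Finsupp.single (PlusTree.bPlus [t]) 1 ⊗ₜ[ℝ] Finsupp.single PBTree.bullet 1)
    else deltaPlusPlain n t

variable {n}

/-- The characters of `PB₊`: unital and multiplicative linear forms. -/
def IsCharacter (g : PBPlus n →ₗ[ℝ] ℝ) : Prop :=
  g (Finsupp.single PlusTree.bullet 1) = 1 ∧ ∀ x y, g (PlusTree.treeProd x y) = g x * g y

/-- `Γ_g = (g ⊗ id) Δ⁺`. -/
noncomputable def gammaOf (g : PBPlus n →ₗ[ℝ] ℝ) : PB n →ₗ[ℝ] PB n :=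
  (TensorProduct.lid ℝ (PB n)).toLinearMap ∘ₗ TensorProduct.map g LinearMap.id ∘ₗ deltaPlus n

variable (n) in
/-- `𝒢 = {Γ_g : g a character of PB₊}`. -/
def structureGroup : Set (PB n →ₗ[ℝ] PB n) := {Γ | ∃ g, IsCharacter g ∧ Γ = gammaOf g}

/-- The index set: all sums `∑ k_i α_i`, with `k_i ∈ ℕ` and `α_0 = 1`, and all these sums
decreased by `1`. -/
def indexSet (α : Fin n → ℝ) : Set ℝ :=
  {a | ∃ (k₀ : ℕ) (k : Fin n → ℕ),
    a = (k₀ : ℝ) + ∑ i, (k i : ℝ) * α i ∨ a = (k₀ : ℝ) + ∑ i, (k i : ℝ) * α i - 1}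

/-- The span `PB_a` of the trees of degree `a`. -/
def homogeneous (α : Fin n → ℝ) (a : ℝ) : Submodule ℝ (PB n) :=
  Finsupp.supported ℝ ℝ {t | t.deg α = a}

end Coaction

/-! ### The `ℓ¹`-norm on `PB`, which normes every `PB_a` -/

section Norm
variable (n : ℕ)

noncomputable instance : Norm (PB n) := ⟨fun v => v.sum fun _ c => |c|⟩

theorem norm_PB_eq_of_subset (v : PB n) (s : Finset (PBTree n)) (h : v.support ⊆ s) :
    ‖v‖ = ∑ t ∈ s, |v t| :=
  Finsupp.sum_of_support_subset v h _ (by simp)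

theorem normedSpaceCore_PB : NormedSpace.Core ℝ (PB n) where
  norm_nonneg v := Finset.sum_nonneg fun _ _ => abs_nonneg _
  norm_smul c v := by
    rw [norm_PB_eq_of_subset n (c • v) v.support Finsupp.support_smul,
      norm_PB_eq_of_subset n v v.support subset_rfl, Finset.mul_sum]
    simp [abs_mul]
  norm_triangle v w := by
    classical
    rw [norm_PB_eq_of_subset n (v + w) (v.support ∪ w.support) Finsupp.support_add,
      norm_PB_eq_of_subset n v (v.support ∪ w.support) Finset.subset_union_left,
      norm_PB_eq_of_subset n w (v.support ∪ w.support) Finset.subset_union_right,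
      ← Finset.sum_add_distrib]
    exact Finset.sum_le_sum fun t _ => abs_add_le _ _
  norm_eq_zero_iff v := by
    rw [norm_PB_eq_of_subset n v v.support subset_rfl,
      Finset.sum_eq_zero_iff_of_nonneg fun _ _ => abs_nonneg _]
    constructor
    · intro h
      ext t
      by_contra hne
      exact hne (by simpa using h t (Finsupp.mem_support_iff.2 hne))
    · rintro rfl
      simp

noncomputable instance : NormedAddCommGroup (PB n) :=
  NormedAddCommGroup.ofCore (normedSpaceCore_PB n)

noncomputable instance : NormedSpace ℝ (PB n) := NormedSpace.ofCore (normedSpaceCore_PB n)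

end Norm

/-! ### Regularity structures and models -/

/-- All the axioms of a regularity structure `(A, T, G)` except for `T_0 ≃ ℝ`: the graded space
`T = ⊕_{a ∈ A} T_a` is the space `V`, each `T_a` is a Banach space for the norm of `V`, and `G` is
a group of linear operators on `V`. -/
structure IsPreRegularityStructure {V : Type*} [NormedAddCommGroup V] [NormedSpace ℝ V]
    (A : Set ℝ) (T : ℝ → Submodule ℝ V) (one : V) (G : Set (V →ₗ[ℝ] V)) : Prop where
  bddBelow : BddBelow A
  locallyFinite : ∀ a b : ℝ, (A ∩ Set.Icc a b).Finite
  independent : iSupIndep fun a : A => T a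
  iSup_eq_top : ⨆ a : A, T a = ⊤
  complete : ∀ a ∈ A, CompleteSpace (T a)
  zero_mem : (0 : ℝ) ∈ A
  one_mem : one ∈ T 0
  one_ne_zero : one ≠ 0
  id_mem : LinearMap.id ∈ G
  comp_mem : ∀ Γ ∈ G, ∀ Γ' ∈ G, Γ ∘ₗ Γ' ∈ G
  inv_mem : ∀ Γ ∈ G, ∃ Γ' ∈ G, Γ ∘ₗ Γ' = LinearMap.id ∧ Γ' ∘ₗ Γ = LinearMap.id
  sub_mem : ∀ Γ ∈ G, ∀ a ∈ A, ∀ v ∈ T a, Γ v - v ∈ ⨆ b : {b // b ∈ A ∧ b < a}, T b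

/-- `(A, T, G)` is a regularity structure, with unit vector `one` of `T_0 ≃ ℝ`. -/
structure IsRegularityStructure {V : Type*} [NormedAddCommGroup V] [NormedSpace ℝ V]
    (A : Set ℝ) (T : ℝ → Submodule ℝ V) (one : V) (G : Set (V →ₗ[ℝ] V)) : Prop
    extends IsPreRegularityStructure A T one G where
  T_zero : T 0 = Submodule.span ℝ {one}

/-- `(Π, Γ)` is a model on `ℝ` for `(A, T, G)`, with values in the space of distributions `D`.
A linear map on `T = ⊕_{a ∈ A} T_a` is continuous when it is so on every `T_a`. -/
structure IsModel {V D : Type*} [NormedAddCommGroup V] [NormedSpace ℝ V]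
    [AddCommGroup D] [Module ℝ D] [TopologicalSpace D]
    (A : Set ℝ) (T : ℝ → Submodule ℝ V) (G : Set (V →ₗ[ℝ] V))
    (Pi : ℝ → V →ₗ[ℝ] D) (Γ : ℝ → ℝ → V →ₗ[ℝ] V) : Prop where
  mem : ∀ x y, Γ x y ∈ G
  self : ∀ x, Γ x x = LinearMap.id
  comp : ∀ x y z, Γ x y ∘ₗ Γ y z = Γ x z
  continuous : ∀ x, ∀ a ∈ A, Continuous fun v : T a => Pi x v
  translate : ∀ x y, Pi y = Pi x ∘ₗ Γ x y

/-! ### The model of a planarly branched rough path -/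

/-- The space `𝓓'(ℝ)` of real distributions on the line. -/
abbrev LineDistribution : Type := Distribution (⊤ : TopologicalSpace.Opens ℝ) ℝ ⊤

namespace PlanarRoughPath
variable {n : ℕ} {γ : ℝ}

/-- `γ_st = B₊(φ(X_st))`, that is, `X_st` regarded as a linear form on `PB₊`. -/
noncomputable def character (X : PlanarRoughPath n γ) (s t : ℝ) : PBPlus n →ₗ[ℝ] ℝ :=
  X.X s t ∘ₗ phiInvBMinus n

/-- `Γ_st = (γ_ts ⊗ id) Δ⁺`. -/
noncomputable def Gamma (X : PlanarRoughPath n γ) (s t : ℝ) : PB n →ₗ[ℝ] PB n :=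
  gammaOf (X.character t s)

/-- The relations defining `Π`, with values in `𝓓'(ℝ)`: `Π_s(B₊(φ(w)))` is the function
`t ↦ ⟨X_st, w⟩`, and `Π_s(τ) = d/dt Π_s(B₊(τ))` if a decorated edge is adjacent to the root
of `τ`. -/
structure DefinesPi (X : PlanarRoughPath n γ) (Pi : ℝ → PB n →ₗ[ℝ] LineDistribution) :
    Prop where
  plain : ∀ s (w : List (VTree n)) (f : 𝓓((⊤ : TopologicalSpace.Opens ℝ), ℝ)),
    MeasureTheory.Integrable (fun t => X.X s t (Finsupp.single w 1) * f t) ∧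
    Pi s (bPlusPhi n (Finsupp.single w 1)) f = ∫ t, X.X s t (Finsupp.single w 1) * f t
  decorated : ∀ s (τ : PBTree n), τ.HasDecoratedRoot →
    Pi s (Finsupp.single τ 1) =
      Distribution.lineDerivCLM (1 : ℝ) (Pi s (Finsupp.single (PBTree.bPlus [τ]) 1))

/-- The relations defining `Π`, with values in the space `𝓢'(ℝ)` of tempered distributions. -/
structure DefinesTemperedPi (X : PlanarRoughPath n γ) (Pi : ℝ → PB n →ₗ[ℝ] 𝓢'(ℝ, ℂ)) :
    Prop where
  plain : ∀ s (w : List (VTree n)) (f : 𝓢(ℝ, ℂ)),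
    MeasureTheory.Integrable (fun t => (X.X s t (Finsupp.single w 1) : ℂ) * f t) ∧
    Pi s (bPlusPhi n (Finsupp.single w 1)) f = ∫ t, (X.X s t (Finsupp.single w 1) : ℂ) * f t
  decorated : ∀ s (τ : PBTree n), τ.HasDecoratedRoot →
    Pi s (Finsupp.single τ 1) =
      TemperedDistribution.derivCLM ℂ (Pi s (Finsupp.single (PBTree.bPlus [τ]) 1))

end PlanarRoughPath

-- Everything reduces to one family of operators on forests. At the root, a left admissible cut of
-- `B₊(w)` cuts off an initial segment `u` of `w = u v`; it then cuts each tree of `v`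
-- independently. For a linear form `g`, weight each trunk by the product of the values of `g` on
-- the forests cut off. Summing gives two mutually recursive operators. `forestHom g` sends `w` to
-- the sum of `g(u) T(v)`, where `T = treeMap g` acts letter by letter, and `T` keeps the root
-- decoration and applies `forestHom g` to the branches. For a character `g` the weight is `g(P^c)`,
-- because `P^c` is a shuffle product; hence `forestHom g = (g ⊗ id) Δ_MKW`, and `φ` carries
-- `treeHom g` to `Γ_g` (`gammaOf_phiLin`). A decorated root fits the same formula: subtracting
-- `B₊(τ) ⊗ •` removes exactly the cut of the only edge at the new root.
--
-- The recursion is deconcatenation followed by letter substitution. Coassociativity of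
-- deconcatenation and induction on trees give `forestHom g ∘ forestHom h = forestHom (g ∘ forestHom
-- h)` for all linear forms (`cutHom_cutHom`, `treeHom_treeMap`). Compatibility of deconcatenation
-- with shuffles makes `forestHom h` multiplicative when `h` is (`cutHom_shuffleProd`). If `g(1) =
-- 1`, the operator is the identity plus terms with fewer vertices, hence bijective. So the
-- characters form a group under convolution, and `𝒢` is a group.
--
-- The degree of a tree is the sum of positive vertex weights minus one (`PBTree.deg_phi`). The same
-- triangularity therefore lowers degrees, and each degree has finitely many trees. A tree of degree
-- zero other than `•` has total weight one and a root decorated by some `i ≠ 0`, which forces a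
-- relation `∑ k_i α_i = 1`; conversely every such relation is realized by a tree.
--
-- Chen's identity says `X_ut ∘ forestHom X_su = X_st`. It yields `X_ss = counit`, the cocycle rule
-- for `Γ` and, with the Hölder bounds, continuity of `t ↦ ⟨X_st, w⟩`, so that these functions
-- define distributions. The translation rule `Π_t = Π_s Γ_st` is Chen's identity on trees with
-- undecorated root. At a decorated root it holds up to a constant function, which the derivative
-- kills (`modelMap_comp_gammaOf`). The relations for `Π` prescribe its values on a basis, whence
-- existence and uniqueness.

/-! ### Words: letter substitutions, deconcatenation and shuffles -/

section Words
variable {β M N : Type*} [AddCommGroup M] [AddCommGroup N]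

/-- Prepend a letter to a word, extended bilinearly. -/
noncomputable def consWord : (β →₀ ℝ) →ₗ[ℝ] (List β →₀ ℝ) →ₗ[ℝ] (List β →₀ ℝ) :=
  Finsupp.linearCombination ℝ fun b => Finsupp.lmapDomain ℝ ℝ (List.cons b)

@[simp]
theorem consWord_single (b : β) (w : List β) :
    consWord (Finsupp.single b 1) (Finsupp.single w 1) = Finsupp.single (b :: w) (1 : ℝ) := by
  simp [consWord]

/-- Two linear maps on a free module agree if they agree on the basis. -/
theorem finsupp_hom_ext [Module ℝ M] {ι : Type*} {f g : (ι →₀ ℝ) →ₗ[ℝ] M}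
    (h : ∀ i, f (Finsupp.single i 1) = g (Finsupp.single i 1)) (x : ι →₀ ℝ) : f x = g x := by
  have : f = g := Finsupp.lhom_ext' fun i => LinearMap.ext_ring (by simpa using h i)
  rw [this]

/-- Substitute a linear combination of letters for every letter of a word. -/
noncomputable def substList (L : β → β →₀ ℝ) : List β → List β →₀ ℝ
  | [] => Finsupp.single [] 1
  | b :: w => consWord (L b) (substList L w)

/-- Letter substitution on the space spanned by words. -/
noncomputable def substHom (L : β → β →₀ ℝ) : (List β →₀ ℝ) →ₗ[ℝ] (List β →₀ ℝ) :=
  Finsupp.linearCombination ℝ (substList L)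

@[simp]
theorem substHom_single (L : β → β →₀ ℝ) (w : List β) :
    substHom L (Finsupp.single w 1) = substList L w := by
  simp [substHom]

theorem substHom_consWord (L : β → β →₀ ℝ) (x : β →₀ ℝ) (y : List β →₀ ℝ) :
    substHom L (consWord x y) = consWord (Finsupp.linearCombination ℝ L x) (substHom L y) := by
  refine finsupp_hom_ext (f := (consWord.compr₂ (substHom L)).flip y)
    (g := (consWord.compl₁₂ (Finsupp.linearCombination ℝ L) (substHom L)).flip y) (fun b => ?_) x
  refine finsupp_hom_ext (f := consWord.compr₂ (substHom L) (Finsupp.single b 1))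
    (g := consWord.compl₁₂ (Finsupp.linearCombination ℝ L) (substHom L) (Finsupp.single b 1))
    (fun w => ?_) y
  simp [substList]

theorem substHom_substList (L M : β → β →₀ ℝ) (w : List β) :
    substHom L (substList M w) =
      substList (fun b => Finsupp.linearCombination ℝ L (M b)) w := by
  induction w with
  | nil => simp [substList]
  | cons b w ih => simp [substList, substHom_consWord, ih]

theorem substList_congr {L M : β → β →₀ ℝ} {w : List β} (h : ∀ b ∈ w, L b = M b) :
    substList L w = substList M w := by
  induction w with
  | nil => rfl
  | cons b w ih => simp [substList, h b (by simp), ih fun b hb => h b (by simp [hb])]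

theorem substList_single (w : List β) :
    substList (fun b => Finsupp.single b 1) w = Finsupp.single w 1 := by
  induction w with
  | nil => rfl
  | cons b w ih => simp [substList, ih]

theorem consWord_apply_nil (x : β →₀ ℝ) (y : List β →₀ ℝ) : consWord x y [] = 0 := by
  refine finsupp_hom_ext (f := (consWord.compr₂ (Finsupp.lapply [])).flip y) (g := 0)
    (fun b => ?_) x
  refine finsupp_hom_ext (f := consWord.compr₂ (Finsupp.lapply []) (Finsupp.single b 1)) (g := 0)
    (fun w => ?_) y
  simp

/-- Membership of `consWord x y` in the span of a set of words. -/
theorem consWord_mem_supported {A : Set β} {B C : Set (List β)}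
    (h : ∀ b ∈ A, ∀ w ∈ B, b :: w ∈ C) {x : β →₀ ℝ} {y : List β →₀ ℝ}
    (hx : x ∈ Finsupp.supported ℝ ℝ A) (hy : y ∈ Finsupp.supported ℝ ℝ B) :
    consWord x y ∈ Finsupp.supported ℝ ℝ C := by
  rw [Finsupp.supported_eq_span_single] at hx hy
  refine Submodule.span_induction₂ (p := fun x y _ _ => consWord x y ∈ Finsupp.supported ℝ ℝ C)
    ?_ ?_ ?_ ?_ ?_ ?_ ?_ hx hy
  · rintro _ _ ⟨b, hb, rfl⟩ ⟨w, hw, rfl⟩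
    simpa using Finsupp.single_mem_supported ℝ (1 : ℝ) (h b hb w hw)
  · simp
  · simp
  · intro x y z _ _ _ h1 h2
    simpa using add_mem h1 h2
  · intro x y z _ _ _ h1 h2
    simpa using add_mem h1 h2
  · intro r x y _ _ h1
    simpa using Submodule.smul_mem _ r h1
  · intro r x y _ _ h1
    simpa using Submodule.smul_mem _ r h1

/-- The sum of `F u v` over all ways to write a word as a concatenation `u ++ v`. -/
def splitSum (F : List β → List β → M) : List β → M
  | [] => F [] []
  | b :: w => F [] (b :: w) + splitSum (fun u v => F (b :: u) v) w

theorem splitSum_congr {F G : List β → List β → M} {w : List β}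
    (h : ∀ u v, u ++ v = w → F u v = G u v) : splitSum F w = splitSum G w := by
  induction w generalizing F G with
  | nil => exact h [] [] rfl
  | cons b w ih =>
    simp only [splitSum, h [] (b :: w) rfl]
    rw [ih fun u v huv => h (b :: u) v (by simp [huv])]

theorem splitSum_add (F G : List β → List β → M) (w : List β) :
    splitSum (fun u v => F u v + G u v) w = splitSum F w + splitSum G w := by
  induction w generalizing F G with
  | nil => rfl
  | cons b w ih => simp only [splitSum, ih]; abel

theorem splitSum_eq_of_forall_ne_nil {F : List β → List β → M} (h : ∀ u v, v ≠ [] → F u v = 0)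
    (w : List β) : splitSum F w = F w [] := by
  induction w generalizing F with
  | nil => rfl
  | cons b w ih =>
    rw [splitSum, ih fun u v hv => h (b :: u) v hv, h [] (b :: w) (by simp), zero_add]

/-- Deconcatenation is coassociative. -/
theorem splitSum_assoc (F : List β → List β → List β → M) (w : List β) :
    splitSum (fun u v => splitSum (fun v₁ v₂ => F u v₁ v₂) v) w =
      splitSum (fun x v₂ => splitSum (fun u v₁ => F u v₁ v₂) x) w := by
  induction w generalizing F with
  | nil => rfl
  | cons b w ih =>
    simp only [splitSum, ih, splitSum_add]
    abel

theorem shuffles_nil_left (w : List β) : shuffles [] w = [w] := by rw [shuffles]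

theorem shuffles_nil_right (v : List β) : shuffles v [] = [v] := by
  cases v <;> rw [shuffles]

theorem shuffles_cons_cons (a b : β) (v w : List β) :
    shuffles (a :: v) (b :: w) =
      (shuffles v (b :: w)).map (a :: ·) ++ (shuffles (a :: v) w).map (b :: ·) := by
  rw [shuffles]

/-- Deconcatenation is multiplicative for the shuffle product. -/
theorem sum_splitSum_shuffles (F : List β → List β → M) (v w : List β) :
    ((shuffles v w).map (splitSum F)).sum =
      splitSum (fun v₁ v₂ => splitSum (fun w₁ w₂ =>
        ((shuffles v₁ w₁).map fun z₁ => ((shuffles v₂ w₂).map fun z₂ => F z₁ z₂).sum).sum) w) v := by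
  induction v generalizing F w with
  | nil => simp [splitSum, shuffles_nil_left]
  | cons a v ihv =>
    induction w generalizing F with
    | nil =>
      simp only [splitSum, shuffles_nil_right, List.map_cons, List.map_nil, List.sum_cons,
        List.sum_nil, add_zero]
    | cons b w ihw =>
      -- For words with a fixed first letter `c`, the splitting with empty left part is separated
      -- from those in which `c` goes to the left.
      have h1 : ∀ (c : β) (l : List (List β)),
          ((l.map (c :: ·)).map (splitSum F)).sum =
            ((l.map (c :: ·)).map (F [])).sum +
              (l.map (splitSum fun u v => F (c :: u) v)).sum := by
        intro c l
        simp only [List.map_map, ← List.sum_map_add]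
        rfl
      rw [shuffles_cons_cons, List.map_append, List.sum_append, h1, h1, ihv, ihw]
      simp only [splitSum, shuffles_nil_left, shuffles_nil_right, shuffles_cons_cons,
        List.map_append, List.sum_append, List.map_map, List.map_cons, List.map_nil,
        List.sum_cons, List.sum_nil, add_zero, splitSum_add, Function.comp_def]
      abel

variable [Module ℝ M] [Module ℝ N]

theorem splitSum_mem {F : List β → List β → M} {w : List β} (P : Submodule ℝ M)
    (h : ∀ u v, u ++ v = w → F u v ∈ P) : splitSum F w ∈ P := by
  induction w generalizing F with
  | nil => exact h [] [] rfl
  | cons b w ih =>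
    exact add_mem (h [] (b :: w) rfl) (ih fun u v huv => h (b :: u) v (by simp [huv]))

theorem map_splitSum (f : M →ₗ[ℝ] N) (F : List β → List β → M) (w : List β) :
    f (splitSum F w) = splitSum (fun u v => f (F u v)) w := by
  induction w generalizing F with
  | nil => rfl
  | cons b w ih => simp only [splitSum, map_add, ih]

theorem splitSum_eq_of_forall_left_ne_nil {F : List β → List β → M}
    (h : ∀ u v, u ≠ [] → F u v = 0) (w : List β) : splitSum F w = F [] w := by
  cases w with
  | nil => rfl
  | cons b w =>
    have h0 : splitSum (fun u v => F (b :: u) v) w ∈ (⊥ : Submodule ℝ M) :=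
      splitSum_mem _ fun u v _ => by simpa using h (b :: u) v (by simp)
    rw [splitSum, (Submodule.mem_bot ℝ).1 h0, add_zero]

/-! #### The shuffle product -/

theorem listSum_append {ι : Type*} (l l' : List ι) : listSum (l ++ l') = listSum l + listSum l' := by
  simp [listSum]

theorem map_listSum {ι : Type*} (f : (ι →₀ ℝ) →ₗ[ℝ] M) (l : List ι) :
    f (listSum l) = (l.map fun i => f (Finsupp.single i 1)).sum := by
  simp [listSum, map_list_sum, Function.comp_def]

theorem shuffleProd_single (v w : List β) :
    shuffleProd (Finsupp.single v 1) (Finsupp.single w 1) = listSum (shuffles v w) := by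
  simp [shuffleProd]

theorem shuffleProd_one_left (x : List β →₀ ℝ) : shuffleProd (Finsupp.single [] 1) x = x :=
  finsupp_hom_ext (f := shuffleProd (Finsupp.single [] 1)) (g := LinearMap.id)
    (fun w => by simp [shuffleProd_single, shuffles_nil_left, listSum]) x

theorem shuffleProd_one_right (x : List β →₀ ℝ) : shuffleProd x (Finsupp.single [] 1) = x :=
  finsupp_hom_ext (f := shuffleProd.flip (Finsupp.single [] 1)) (g := LinearMap.id)
    (fun w => by simp [shuffleProd_single, shuffles_nil_right, listSum]) x

/-- The shuffle recursion on first letters, extended by linearity. Substitution turns a letter into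
a combination of letters, so the recursion is needed in this generality. -/
theorem shuffleProd_consWord (x x' : β →₀ ℝ) (y y' : List β →₀ ℝ) :
    shuffleProd (consWord x y) (consWord x' y') =
      consWord x (shuffleProd y (consWord x' y')) +
        consWord x' (shuffleProd (consWord x y) y') := by
  induction x using Finsupp.induction_linear with
  | zero => simp
  | add x₁ x₂ h₁ h₂ => simp only [map_add, LinearMap.add_apply, h₁, h₂]; abel
  | single a r =>
  induction x' using Finsupp.induction_linear with
  | zero => simp
  | add x₁ x₂ h₁ h₂ => simp only [map_add, LinearMap.add_apply, h₁, h₂]; abel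
  | single b s =>
  induction y using Finsupp.induction_linear with
  | zero => simp
  | add x₁ x₂ h₁ h₂ => simp only [map_add, LinearMap.add_apply, h₁, h₂]; abel
  | single v p =>
  induction y' using Finsupp.induction_linear with
  | zero => simp
  | add x₁ x₂ h₁ h₂ => simp only [map_add, h₁, h₂]; abel
  | single w q =>
  have e : ∀ {ι : Type _} (i : ι) (c : ℝ), Finsupp.single i c = c • Finsupp.single i (1 : ℝ) := by
    intro ι i c; simp
  have key : shuffleProd (Finsupp.single (a :: v) 1) (Finsupp.single (b :: w) 1) =
      consWord (Finsupp.single a 1) (shuffleProd (Finsupp.single v 1) (Finsupp.single (b :: w) 1)) +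
      consWord (Finsupp.single b 1)
        (shuffleProd (Finsupp.single (a :: v) 1) (Finsupp.single w 1)) := by
    simp only [shuffleProd_single, shuffles_cons_cons, listSum_append, map_listSum, consWord_single]
    simp [listSum, Function.comp_def]
  rw [e a, e b, e v, e w]
  simp only [map_smul, LinearMap.smul_apply, consWord_single, key, smul_add]
  simp only [smul_smul]
  congr 2
  all_goals ring

/-- Letter substitutions are multiplicative for the shuffle product. -/
theorem substHom_shuffleProd (L : β → β →₀ ℝ) (x y : List β →₀ ℝ) :
    substHom L (shuffleProd x y) = shuffleProd (substHom L x) (substHom L y) := by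
  refine finsupp_hom_ext (f := (shuffleProd.compr₂ (substHom L)).flip y)
    (g := (shuffleProd.compl₁₂ (substHom L) (substHom L)).flip y) (fun v => ?_) x
  refine finsupp_hom_ext (f := shuffleProd.compr₂ (substHom L) (Finsupp.single v 1))
    (g := shuffleProd.compl₁₂ (substHom L) (substHom L) (Finsupp.single v 1)) (fun w => ?_) y
  simp only [LinearMap.compr₂_apply, LinearMap.compl₁₂_apply, substHom_single]
  induction v generalizing w with
  | nil => simp [shuffleProd_one_left, substList]
  | cons a v ihv =>
    induction w with
    | nil => simp [shuffleProd_one_right, substList]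
    | cons b w ihw =>
      rw [← consWord_single a v, ← consWord_single b w, shuffleProd_consWord, map_add,
        substHom_consWord, substHom_consWord, consWord_single, consWord_single, ihv, ihw]
      simp only [substList, shuffleProd_consWord, Finsupp.linearCombination_single, one_smul]

/-! #### Deconcatenation followed by a linear form and a letter substitution -/

/-- A bilinear map composed with deconcatenation. -/
noncomputable def splitHom (B : (List β →₀ ℝ) →ₗ[ℝ] (List β →₀ ℝ) →ₗ[ℝ] M) :
    (List β →₀ ℝ) →ₗ[ℝ] M :=
  Finsupp.linearCombination ℝ
    (splitSum fun u v => B (Finsupp.single u 1) (Finsupp.single v 1))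

@[simp]
theorem splitHom_single (B : (List β →₀ ℝ) →ₗ[ℝ] (List β →₀ ℝ) →ₗ[ℝ] M) (w : List β) :
    splitHom B (Finsupp.single w 1) =
      splitSum (fun u v => B (Finsupp.single u 1) (Finsupp.single v 1)) w := by
  simp [splitHom]

/-- Either the left part of the splitting is empty or it contains the first letter; again the letter
may be a linear combination. -/
theorem splitHom_consWord (B : (List β →₀ ℝ) →ₗ[ℝ] (List β →₀ ℝ) →ₗ[ℝ] M) (x : β →₀ ℝ)
    (y : List β →₀ ℝ) :
    splitHom B (consWord x y) =
      B (Finsupp.single [] 1) (consWord x y) + splitHom (B ∘ₗ consWord x) y := by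
  induction y using Finsupp.induction_linear with
  | zero => simp
  | add y₁ y₂ h₁ h₂ => simp only [map_add, h₁, h₂]; abel
  | single w r =>
    have e : Finsupp.single w r = r • Finsupp.single w (1 : ℝ) := by simp
    rw [e]
    simp only [map_smul, ← smul_add]
    congr 1
    induction x using Finsupp.induction_linear with
    | zero =>
      have h0 : splitSum (fun (_ _ : List β) => (0 : M)) w ∈ (⊥ : Submodule ℝ M) :=
        splitSum_mem _ fun _ _ _ => rfl
      simpa using h0.symm
    | add x₁ x₂ h₁ h₂ =>
      simp only [map_add, LinearMap.add_apply, h₁, h₂, splitHom_single, LinearMap.comp_apply,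
        splitSum_add]
      abel
    | single b s =>
      have e : Finsupp.single b s = s • Finsupp.single b (1 : ℝ) := by simp
      rw [e]
      simp only [map_smul, LinearMap.smul_apply, consWord_single, splitHom_single,
        LinearMap.comp_apply, splitSum, smul_add]
      rw [← LinearMap.lsmul_apply (R := ℝ) s (splitSum _ _), map_splitSum]
      rfl

/-- A substitution acts on each letter separately, so it may be performed before or after the word
is split. -/
theorem splitHom_substList (B : (List β →₀ ℝ) →ₗ[ℝ] (List β →₀ ℝ) →ₗ[ℝ] M) (L : β → β →₀ ℝ)
    (w : List β) :
    splitHom B (substList L w) = splitSum (fun u v => B (substList L u) (substList L v)) w := by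
  induction w generalizing B with
  | nil => simp [substList, splitSum]
  | cons b w ih => simp [substList, splitSum, splitHom_consWord, ih]

/-- The map `w ↦ ∑ g(u) L(v)`, the sum over all ways to write `w` as a concatenation `u v`. -/
noncomputable def cutHom (g : (List β →₀ ℝ) →ₗ[ℝ] ℝ) (L : β → β →₀ ℝ) :
    (List β →₀ ℝ) →ₗ[ℝ] (List β →₀ ℝ) :=
  splitHom ((LinearMap.lsmul ℝ (List β →₀ ℝ) ∘ₗ g).compl₂ (substHom L))

theorem cutHom_single (g : (List β →₀ ℝ) →ₗ[ℝ] ℝ) (L : β → β →₀ ℝ) (w : List β) :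
    cutHom g L (Finsupp.single w 1) =
      splitSum (fun u v => g (Finsupp.single u 1) • substList L v) w := by
  simp [cutHom]

/-- Both sides are the sum over `w = u v₁ v₂` of `h(u) g(M v₁) LM(v₂)`, bracketed in the two
possible ways. Multiplicativity of `g` and `h` plays no role. -/
theorem cutHom_cutHom (g h : (List β →₀ ℝ) →ₗ[ℝ] ℝ) (L M : β → β →₀ ℝ) (x : List β →₀ ℝ) :
    cutHom g L (cutHom h M x) =
      cutHom (g ∘ₗ cutHom h M) (fun b => Finsupp.linearCombination ℝ L (M b)) x := by
  refine finsupp_hom_ext (f := cutHom g L ∘ₗ cutHom h M) (fun w => ?_) x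
  rw [LinearMap.comp_apply, cutHom_single, cutHom_single, map_splitSum]
  have h1 : ∀ u v, cutHom g L (h (Finsupp.single u 1) • substList M v) =
      splitSum (fun v₁ v₂ => h (Finsupp.single u 1) • g (substList M v₁) •
        substList (fun b => Finsupp.linearCombination ℝ L (M b)) v₂) v := by
    intro u v
    rw [map_smul, cutHom, splitHom_substList, ← LinearMap.lsmul_apply (R := ℝ) _ (splitSum _ _),
      map_splitSum]
    simp only [LinearMap.compl₂_apply, LinearMap.comp_apply, LinearMap.lsmul_apply,
      substHom_substList]
  have h2 : ∀ u v, (g ∘ₗ cutHom h M) (Finsupp.single u 1) •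
      substList (fun b => Finsupp.linearCombination ℝ L (M b)) v =
      splitSum (fun v₁ v₂ => h (Finsupp.single v₁ 1) • g (substList M v₂) •
        substList (fun b => Finsupp.linearCombination ℝ L (M b)) v) u := by
    intro u v
    rw [LinearMap.comp_apply, cutHom_single]
    have := map_splitSum ((LinearMap.toSpanSingleton ℝ _
      (substList (fun b => Finsupp.linearCombination ℝ L (M b)) v)) ∘ₗ g)
      (fun u v => h (Finsupp.single u 1) • substList M v) u
    simpa [smul_smul] using this
  simp only [h1, h2]
  exact splitSum_assoc _ w

/-- A substituted nonempty word has no component on the empty word, so only the splitting with empty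
right part counts. -/
theorem cutHom_apply_nil (g : (List β →₀ ℝ) →ₗ[ℝ] ℝ) (L : β → β →₀ ℝ) (x : List β →₀ ℝ) :
    cutHom g L x [] = g x := by
  refine finsupp_hom_ext (f := Finsupp.lapply [] ∘ₗ cutHom g L) (fun w => ?_) x
  rw [LinearMap.comp_apply, cutHom_single, map_splitSum, splitSum_eq_of_forall_ne_nil]
  · simp [substList]
  · intro u v hv
    obtain ⟨b, w, rfl⟩ := List.exists_cons_of_ne_nil hv
    simp [substList, consWord_apply_nil]

/-- The map `cutHom g L` is multiplicative for the shuffle product if `g` is. -/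
theorem cutHom_shuffleProd {g : (List β →₀ ℝ) →ₗ[ℝ] ℝ}
    (hg : ∀ x y, g (shuffleProd x y) = g x * g y) (L : β → β →₀ ℝ) (x y : List β →₀ ℝ) :
    cutHom g L (shuffleProd x y) = shuffleProd (cutHom g L x) (cutHom g L y) := by
  refine finsupp_hom_ext (f := (shuffleProd.compr₂ (cutHom g L)).flip y)
    (g := (shuffleProd.compl₁₂ (cutHom g L) (cutHom g L)).flip y) (fun v => ?_) x
  refine finsupp_hom_ext (f := shuffleProd.compr₂ (cutHom g L) (Finsupp.single v 1))
    (g := shuffleProd.compl₁₂ (cutHom g L) (cutHom g L) (Finsupp.single v 1)) (fun w => ?_) y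
  simp only [LinearMap.compr₂_apply, LinearMap.compl₁₂_apply]
  rw [shuffleProd_single, map_listSum]
  simp only [cutHom_single]
  rw [sum_splitSum_shuffles, ← LinearMap.flip_apply (f := shuffleProd), map_splitSum]
  refine splitSum_congr fun v₁ v₂ _ => ?_
  rw [LinearMap.flip_apply, map_splitSum]
  refine splitSum_congr fun w₁ w₂ _ => ?_
  -- After splitting, the right parts are shuffled and substituted, and the left parts are shuffled
  -- and evaluated by `g`; multiplicativity of the substitution and of `g` handles the two factors.
  have h1 : ∀ r : ℝ, ((shuffles v₂ w₂).map fun z₂ => r • substList L z₂).sum =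
      r • shuffleProd (substList L v₂) (substList L w₂) := by
    intro r
    have h := substHom_shuffleProd L (Finsupp.single v₂ 1) (Finsupp.single w₂ 1)
    rw [shuffleProd_single, map_listSum] at h
    simp only [substHom_single] at h
    rw [← h, List.smul_sum, List.map_map]
    rfl
  have h2 := hg (Finsupp.single v₁ 1) (Finsupp.single w₁ 1)
  rw [shuffleProd_single, map_listSum] at h2
  simp only [h1]
  rw [map_smul, map_smul, LinearMap.smul_apply, smul_smul, mul_comm (g _), ← h2,
    List.sum_smul, List.map_map]
  rfl

end Words

/-! ### Cutting forests with a linear form -/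

namespace VTree
variable {n : ℕ}

theorem inductionOn {P : VTree n → Prop}
    (h : ∀ c ts, (∀ t ∈ ts, P t) → P (node c ts)) : ∀ t, P t
  | node c ts => h c ts fun t ht =>
      have := List.sizeOf_lt_of_mem ht
      inductionOn h t
termination_by t => sizeOf t
decreasing_by simp; omega

/-- The product of the values of a linear form on the forests of a list. -/
noncomputable def cutWeight (g : OF n →ₗ[ℝ] ℝ) (P : List (List (VTree n))) : ℝ :=
  (P.map fun u => g (Finsupp.single u 1)).prod

/-- The sum over the left admissible cuts of a tree of the trunk weighted by the value of `g` on
the pruned part. -/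
noncomputable def treeMap (g : OF n →ₗ[ℝ] ℝ) (t : VTree n) : VTree n →₀ ℝ :=
  ((treeCuts t).map fun p => cutWeight g p.1 • Finsupp.single p.2 (1 : ℝ)).sum

/-- The linear extension of `treeMap`. -/
noncomputable def treeHom (g : OF n →ₗ[ℝ] ℝ) : (VTree n →₀ ℝ) →ₗ[ℝ] (VTree n →₀ ℝ) :=
  Finsupp.linearCombination ℝ (treeMap g)

/-- The sum over the left admissible cuts of a forest of the trunk weighted by the value of `g` on
the pruned part. -/
noncomputable def forestHom (g : OF n →ₗ[ℝ] ℝ) : OF n →ₗ[ℝ] OF n := cutHom g (treeMap g)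

@[simp]
theorem treeHom_single (g : OF n →ₗ[ℝ] ℝ) (t : VTree n) :
    treeHom g (Finsupp.single t 1) = treeMap g t := by
  simp [treeHom]

/-- Cuts inside the first branch and inside the later ones are chosen independently, so the sum
factors. The constant `a` is the weight of what has been cut at the vertex itself. -/
theorem sum_treeCuts_keepCuts (g : OF n →ₗ[ℝ] ℝ) (a : ℝ) (t : VTree n) (ts : List (VTree n)) :
    ((treeCuts t).flatMap fun p => (keepCuts ts).map fun q =>
        (a * (cutWeight g p.1 * cutWeight g q.1)) • Finsupp.single (p.2 :: q.2) (1 : ℝ)).sum =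
      a • consWord (treeMap g t)
        ((keepCuts ts).map fun q => cutWeight g q.1 • Finsupp.single q.2 (1 : ℝ)).sum := by
  have h : ∀ p : List (List (VTree n)) × VTree n,
      ((keepCuts ts).map fun q =>
        (a * (cutWeight g p.1 * cutWeight g q.1)) • Finsupp.single (p.2 :: q.2) (1 : ℝ)).sum =
      a • (consWord.flip ((keepCuts ts).map fun q =>
        cutWeight g q.1 • Finsupp.single q.2 (1 : ℝ)).sum)
          (cutWeight g p.1 • Finsupp.single p.2 1) := by
    intro p
    rw [LinearMap.flip_apply, map_list_sum, List.map_map, List.smul_sum, List.map_map]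
    congr 1
    refine List.map_congr_left fun q _ => ?_
    simp only [Function.comp_apply, map_smul, LinearMap.smul_apply, consWord_single, smul_smul]
    congr 1
    ring
  rw [List.flatMap_def, List.sum_flatten, List.map_map]
  simp only [Function.comp_def, h]
  generalize ((keepCuts ts).map fun q => cutWeight g q.1 • Finsupp.single q.2 (1 : ℝ)).sum = y
  rw [← LinearMap.flip_apply (f := consWord), treeMap, map_list_sum, List.smul_sum, List.map_map,
    List.map_map]
  rfl

theorem sum_keepCuts (g : OF n →ₗ[ℝ] ℝ) (ts : List (VTree n)) :
    ((keepCuts ts).map fun q => cutWeight g q.1 • Finsupp.single q.2 (1 : ℝ)).sum =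
      substList (treeMap g) ts := by
  induction ts with
  | nil => simp [keepCuts, cutWeight, substList]
  | cons t ts ih =>
    have h := sum_treeCuts_keepCuts g 1 t ts
    rw [ih, one_smul] at h
    rw [substList, ← h]
    simp [keepCuts, List.map_flatMap, cutWeight, Function.comp_def]

/-- `pre` collects the edges already cut at the vertex; the splitting records how many further
consecutive edges are cut before the first one that is kept. -/
theorem sum_prefixCuts (g : OF n →ₗ[ℝ] ℝ) (pre ts : List (VTree n)) :
    ((prefixCuts pre ts).map fun p => cutWeight g p.1 • Finsupp.single p.2 (1 : ℝ)).sum =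
      splitSum (fun u v => g (Finsupp.single (pre ++ u) 1) • substList (treeMap g) v) ts := by
  induction ts generalizing pre with
  | nil => simp [prefixCuts, cutWeight, substList, splitSum]
  | cons t ts ih =>
    have h := sum_treeCuts_keepCuts g (g (Finsupp.single pre 1)) t ts
    rw [sum_keepCuts] at h
    rw [prefixCuts, List.map_append, List.sum_append, ih, splitSum, List.append_nil, substList, ← h]
    simp [List.map_flatMap, cutWeight, Function.comp_def]

theorem forestHom_single (g : OF n →ₗ[ℝ] ℝ) (w : List (VTree n)) :
    forestHom g (Finsupp.single w 1) =
      ((forestCuts w).map fun p => cutWeight g p.1 • Finsupp.single p.2 (1 : ℝ)).sum := by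
  rw [forestHom, cutHom_single, forestCuts, sum_prefixCuts]
  rfl

/-- The cuts of a tree are those of `B₊` of its branches, with the root decoration carried along.
This closes the recursion and permits induction on trees. -/
theorem treeMap_node (g : OF n →ₗ[ℝ] ℝ) (c : Fin (n + 1)) (ts : List (VTree n)) :
    treeMap g (node c ts) =
      Finsupp.lmapDomain ℝ ℝ (node c) (forestHom g (Finsupp.single ts 1)) := by
  rw [forestHom_single, map_list_sum, List.map_map, treeMap, treeCuts, List.map_map, forestCuts]
  congr 1
  refine List.map_congr_left fun p _ => ?_
  simp

theorem treeHom_lmapDomain_node (g : OF n →ₗ[ℝ] ℝ) (c : Fin (n + 1)) (x : OF n) :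
    treeHom g (Finsupp.lmapDomain ℝ ℝ (node c) x) =
      Finsupp.lmapDomain ℝ ℝ (node c) (forestHom g x) :=
  finsupp_hom_ext (f := treeHom g ∘ₗ Finsupp.lmapDomain ℝ ℝ (node c))
    (g := Finsupp.lmapDomain ℝ ℝ (node c) ∘ₗ forestHom g)
    (fun w => by
      have := treeMap_node g c w
      simp_all) x

theorem cutHom_single_congr (g : OF n →ₗ[ℝ] ℝ) {L M : VTree n → VTree n →₀ ℝ}
    {w : List (VTree n)} (h : ∀ t ∈ w, L t = M t) :
    cutHom g L (Finsupp.single w 1) = cutHom g M (Finsupp.single w 1) := by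
  rw [cutHom_single, cutHom_single]
  refine splitSum_congr fun u v huv => ?_
  rw [substList_congr fun t ht => h t (by simp [← huv, ht])]

/-- The coassociativity of the coproduct, for the operators obtained from linear forms. -/
theorem treeHom_treeMap (g h : OF n →ₗ[ℝ] ℝ) (t : VTree n) :
    treeHom g (treeMap h t) = treeMap (g ∘ₗ forestHom h) t := by
  induction t using inductionOn with
  | h c ts ih =>
    rw [treeMap_node, treeHom_lmapDomain_node, treeMap_node, forestHom, forestHom, forestHom,
      cutHom_cutHom]
    congr 1
    exact cutHom_single_congr _ ih

theorem forestHom_forestHom (g h : OF n →ₗ[ℝ] ℝ) (x : OF n) :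
    forestHom g (forestHom h x) = forestHom (g ∘ₗ forestHom h) x := by
  rw [forestHom, forestHom, forestHom, cutHom_cutHom]
  exact congrArg (fun L => cutHom _ L x) (funext fun t => treeHom_treeMap g h t)

theorem treeHom_treeHom (g h : OF n →ₗ[ℝ] ℝ) (x : VTree n →₀ ℝ) :
    treeHom g (treeHom h x) = treeHom (g ∘ₗ forestHom h) x :=
  finsupp_hom_ext (f := treeHom g ∘ₗ treeHom h) (fun t => by simp [treeHom_treeMap]) x

/-- The counit: the coefficient of the empty forest. -/
noncomputable def counit (n : ℕ) : OF n →ₗ[ℝ] ℝ := Finsupp.lapply []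

theorem counit_single_of_ne_nil {w : List (VTree n)} (h : w ≠ []) (r : ℝ) :
    counit n (Finsupp.single w r) = 0 := by
  simp [counit, h]

@[simp]
theorem counit_single_nil (r : ℝ) : counit n (Finsupp.single [] r) = r := by simp [counit]

/-- The linear form is recovered from its operator, so identities between forms can be proved for
operators. -/
theorem counit_comp_forestHom (g : OF n →ₗ[ℝ] ℝ) : counit n ∘ₗ forestHom g = g :=
  LinearMap.ext fun x => cutHom_apply_nil g (treeMap g) x

theorem cutHom_counit_single (L : VTree n → VTree n →₀ ℝ) (w : List (VTree n)) :
    cutHom (counit n) L (Finsupp.single w 1) = substList L w := by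
  rw [cutHom_single, splitSum_eq_of_forall_left_ne_nil]
  · simp
  · intro u v hu
    simp [counit_single_of_ne_nil hu]

theorem treeMap_counit (t : VTree n) : treeMap (counit n) t = Finsupp.single t 1 := by
  induction t using inductionOn with
  | h c ts ih =>
    rw [treeMap_node, forestHom, cutHom_counit_single, substList_congr ih, substList_single]
    simp

theorem treeHom_counit (x : VTree n →₀ ℝ) : treeHom (counit n) x = x :=
  finsupp_hom_ext (f := treeHom (counit n)) (g := LinearMap.id)
    (fun t => by simp [treeMap_counit]) x

theorem forestHom_counit (x : OF n) : forestHom (counit n) x = x :=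
  finsupp_hom_ext (f := forestHom (counit n)) (g := LinearMap.id)
    (fun w => by
      rw [forestHom, cutHom_counit_single, substList_congr fun t _ => treeMap_counit t,
        substList_single, LinearMap.id_apply]) x

/-! #### Triangularity -/

mutual
/-- The sum of the weights of the vertices of a tree. -/
def wt (a : Fin (n + 1) → ℝ) : VTree n → ℝ
  | node c ts => a c + wtList a ts
/-- The sum of the weights of the vertices of a forest. -/
def wtList (a : Fin (n + 1) → ℝ) : List (VTree n) → ℝ
  | [] => 0
  | t :: ts => wt a t + wtList a ts
end

theorem wtList_append (a : Fin (n + 1) → ℝ) (u v : List (VTree n)) :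
    wtList a (u ++ v) = wtList a u + wtList a v := by
  induction u with
  | nil => simp [wtList]
  | cons t u ih => simp [wtList, ih, add_assoc]

theorem wtList_nonneg {a : Fin (n + 1) → ℝ} {w : List (VTree n)}
    (h : ∀ t ∈ w, 0 ≤ wt a t) : 0 ≤ wtList a w := by
  induction w with
  | nil => simp [wtList]
  | cons t w ih =>
    simp only [List.forall_mem_cons] at h
    exact add_nonneg h.1 (ih h.2)

theorem wt_pos {a : Fin (n + 1) → ℝ} (ha : ∀ c, 0 < a c) (t : VTree n) : 0 < wt a t := by
  induction t using inductionOn with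
  | h c ts ih =>
    rw [wt]
    exact add_pos_of_pos_of_nonneg (ha c) (wtList_nonneg fun t ht => (ih t ht).le)

/-- The span of the trees of weight less than `r`. -/
noncomputable def lowTrees (a : Fin (n + 1) → ℝ) (r : ℝ) : Submodule ℝ (VTree n →₀ ℝ) :=
  Finsupp.supported ℝ ℝ {t | wt a t < r}

/-- The span of the forests of weight less than `r`. -/
noncomputable def lowForests (a : Fin (n + 1) → ℝ) (r : ℝ) : Submodule ℝ (OF n) :=
  Finsupp.supported ℝ ℝ {w | wtList a w < r}

/-- Writing each `L t` as `t` plus lower terms and expanding the word, every term except the word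
itself contains at least one lower letter. -/
theorem substList_sub_single_mem {a : Fin (n + 1) → ℝ} {L : VTree n → VTree n →₀ ℝ}
    {w : List (VTree n)} (h : ∀ t ∈ w, L t - Finsupp.single t 1 ∈ lowTrees a (wt a t)) :
    substList L w - Finsupp.single w 1 ∈ lowForests a (wtList a w) := by
  induction w with
  | nil => simp [substList]
  | cons t w ih =>
    simp only [List.forall_mem_cons] at h
    have e : substList L (t :: w) - Finsupp.single (t :: w) 1 =
        consWord (L t - Finsupp.single t 1) (substList L w - Finsupp.single w 1) +
          consWord (L t - Finsupp.single t 1) (Finsupp.single w 1) +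
          consWord (Finsupp.single t 1) (substList L w - Finsupp.single w 1) := by
      simp only [substList, map_sub, LinearMap.sub_apply, consWord_single]
      abel
    rw [e]
    refine add_mem (add_mem ?_ ?_) ?_
    · refine consWord_mem_supported (fun s hs v hv => ?_) h.1 (ih h.2)
      rw [Set.mem_ofPred_eq] at hs hv ⊢
      exact add_lt_add hs hv
    · refine consWord_mem_supported (fun s hs v hv => ?_) h.1
        (Finsupp.single_mem_supported ℝ _ (Set.mem_singleton w))
      obtain rfl := hv
      rw [Set.mem_ofPred_eq] at hs ⊢
      exact add_lt_add_left hs _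
    · refine consWord_mem_supported (fun s hs v hv => ?_)
        (Finsupp.single_mem_supported ℝ _ (Set.mem_singleton t)) (ih h.2)
      obtain rfl := hs
      rw [Set.mem_ofPred_eq] at hv ⊢
      exact add_lt_add_right hv _

/-- Cutting nothing at the root has coefficient `g(1) = 1` and produces the leading term; every
other cut removes a nonempty initial segment, which has positive weight. -/
theorem cutHom_sub_single_mem {a : Fin (n + 1) → ℝ} (ha : ∀ c, 0 < a c) {g : OF n →ₗ[ℝ] ℝ}
    (hg : g (Finsupp.single [] 1) = 1) {L : VTree n → VTree n →₀ ℝ} {w : List (VTree n)}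
    (h : ∀ t ∈ w, L t - Finsupp.single t 1 ∈ lowTrees a (wt a t)) :
    cutHom g L (Finsupp.single w 1) - Finsupp.single w 1 ∈ lowForests a (wtList a w) := by
  rw [cutHom_single]
  cases w with
  | nil => simp [splitSum, hg, substList]
  | cons t w =>
    rw [splitSum, hg, one_smul, add_sub_right_comm]
    -- In the remaining splittings the part cut off is `t :: u`, so the trunk comes from `v`, whose
    -- weight is smaller by at least that of `t`.
    refine add_mem (substList_sub_single_mem h) (splitSum_mem _ fun u v huv => ?_)
    refine Submodule.smul_mem _ _ ?_
    have hv : wtList a v < wtList a (t :: w) := by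
      rw [wtList, ← huv, wtList_append]
      linarith [wt_pos ha t, wtList_nonneg fun s (_ : s ∈ u) => (wt_pos ha s).le]
    have h1 : substList L v - Finsupp.single v 1 ∈ lowForests a (wtList a v) :=
      substList_sub_single_mem fun s hs => h s (by simp [← huv, hs])
    have h2 := add_mem (Finsupp.supported_mono (fun z hz => lt_trans hz hv) h1)
      (Finsupp.single_mem_supported ℝ (1 : ℝ) (s := {w' | wtList a w' < wtList a (t :: w)}) hv)
    rwa [sub_add_cancel] at h2

theorem treeMap_sub_single_mem {a : Fin (n + 1) → ℝ} (ha : ∀ c, 0 < a c) {g : OF n →ₗ[ℝ] ℝ}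
    (hg : g (Finsupp.single [] 1) = 1) (t : VTree n) :
    treeMap g t - Finsupp.single t 1 ∈ lowTrees a (wt a t) := by
  induction t using inductionOn with
  | h c ts ih =>
    have h := cutHom_sub_single_mem ha hg ih
    have e : treeMap g (node c ts) - Finsupp.single (node c ts) 1 =
        Finsupp.lmapDomain ℝ ℝ (node c)
          (cutHom g (treeMap g) (Finsupp.single ts 1) - Finsupp.single ts 1) := by
      rw [map_sub, treeMap_node]
      simp [forestHom]
    rw [e]
    have h' := Submodule.mem_map_of_mem (f := Finsupp.lmapDomain ℝ ℝ (node c)) h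
    rw [lowForests, Finsupp.lmapDomain_supported] at h'
    refine Finsupp.supported_mono ?_ h'
    rintro _ ⟨w, hw, rfl⟩
    rw [Set.mem_ofPred_eq] at hw ⊢
    exact add_lt_add_right hw _

theorem forestHom_sub_single_mem {a : Fin (n + 1) → ℝ} (ha : ∀ c, 0 < a c) {g : OF n →ₗ[ℝ] ℝ}
    (hg : g (Finsupp.single [] 1) = 1) (w : List (VTree n)) :
    forestHom g (Finsupp.single w 1) - Finsupp.single w 1 ∈ lowForests a (wtList a w) :=
  cutHom_sub_single_mem ha hg fun t _ => treeMap_sub_single_mem ha hg t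

theorem wtList_eq_sum (a : Fin (n + 1) → ℝ) (w : List (VTree n)) :
    wtList a w = (w.map (wt a)).sum := by
  induction w with
  | nil => rfl
  | cons t w ih => simp [wtList, ih]

theorem sizeList_eq_sum (w : List (VTree n)) : sizeList w = (w.map size).sum := by
  induction w with
  | nil => rfl
  | cons t w ih => simp [sizeList, ih]

theorem wt_one (t : VTree n) : wt (fun _ => 1) t = size t := by
  induction t using inductionOn with
  | h c ts ih =>
    rw [wt, size, wtList_eq_sum, sizeList_eq_sum, List.map_congr_left ih]
    simp [add_comm, Nat.cast_list_sum, Function.comp_def]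

theorem wtList_one (w : List (VTree n)) : wtList (fun _ => 1) w = sizeList w := by
  rw [wtList_eq_sum, sizeList_eq_sum, List.map_congr_left fun t _ => wt_one t]
  simp [Nat.cast_list_sum, Function.comp_def]

theorem sizeList_pos {w : List (VTree n)} (h : w ≠ []) : 0 < sizeList w := by
  cases w with
  | nil => exact absurd rfl h
  | cons t w =>
    cases t
    simp only [sizeList, size]
    omega

/-- The span of the forests with fewer than `k` vertices. -/
noncomputable def smallForests (n k : ℕ) : Submodule ℝ (OF n) :=
  Finsupp.supported ℝ ℝ {w | sizeList w < k}

theorem mem_smallForests (x : OF n) : ∃ k, x ∈ smallForests n k := by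
  refine ⟨x.support.sup sizeList + 1, (Finsupp.mem_supported ℝ x).2 fun w hw => ?_⟩
  exact Nat.lt_succ_of_le (Finset.le_sup (f := sizeList) hw)

/-- Triangularity for the weight that is `1` on every vertex: the difference loses at least one
vertex, so the operator minus the identity is locally nilpotent. -/
theorem forestHom_sub_self_mem {g : OF n →ₗ[ℝ] ℝ} (hg : g (Finsupp.single [] 1) = 1) {k : ℕ}
    {x : OF n} (hx : x ∈ smallForests n (k + 1)) : forestHom g x - x ∈ smallForests n k := by
  rw [smallForests, Finsupp.supported_eq_span_single] at hx
  refine Submodule.span_induction (p := fun x _ => forestHom g x - x ∈ smallForests n k)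
    ?_ ?_ ?_ ?_ hx
  · rintro _ ⟨w, hw, rfl⟩
    refine Finsupp.supported_mono ?_ (forestHom_sub_single_mem (fun _ => one_pos) hg w)
    intro v hv
    simp only [wtList_one, Set.mem_ofPred_eq, Nat.cast_lt] at hv hw ⊢
    omega
  · simp
  · intro x y _ _ h1 h2
    simpa [add_sub_add_comm] using add_mem h1 h2
  · intro r x _ h1
    simpa [smul_sub] using Submodule.smul_mem _ r h1

/-- Induction on a bound for the number of vertices. An element of the kernel equals minus its own
error term, hence has fewer vertices; a preimage of `x` is `x` minus a preimage of the error
`forestHom g x - x`. -/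
theorem forestHom_bijective {g : OF n →ₗ[ℝ] ℝ} (hg : g (Finsupp.single [] 1) = 1) :
    Function.Bijective (forestHom g) := by
  have h0 : ∀ x ∈ smallForests n 0, x = 0 := by
    intro x hx
    have : {w : List (VTree n) | sizeList w < 0} = ∅ := by simp
    rw [smallForests, this, Finsupp.supported_empty] at hx
    simpa using hx
  constructor
  · rw [injective_iff_map_eq_zero]
    intro x hx
    obtain ⟨k, hk⟩ := mem_smallForests x
    induction k with
    | zero => exact h0 x hk
    | succ k ih =>
      have := forestHom_sub_self_mem hg hk
      rw [hx, zero_sub, Submodule.neg_mem_iff] at this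
      exact ih this
  · intro x
    obtain ⟨k, hk⟩ := mem_smallForests x
    induction k generalizing x with
    | zero => exact ⟨0, by rw [h0 x hk, map_zero]⟩
    | succ k ih =>
      obtain ⟨y, hy⟩ := ih _ (forestHom_sub_self_mem hg hk)
      exact ⟨x - y, by rw [map_sub, hy, sub_sub_cancel]⟩

/-! #### Characters -/

/-- The characters of the shuffle algebra of forests. -/
def IsForestCharacter (g : OF n →ₗ[ℝ] ℝ) : Prop :=
  g (Finsupp.single [] 1) = 1 ∧ ∀ x y, g (shuffleProd x y) = g x * g y

/-- A shuffle of two words is empty only if both words are. -/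
theorem isForestCharacter_counit : IsForestCharacter (counit n) := by
  refine ⟨by simp, fun x y => ?_⟩
  refine finsupp_hom_ext (f := (shuffleProd.compr₂ (counit n)).flip y)
    (g := counit n y • counit n) (fun v => ?_) x |>.trans (mul_comm _ _)
  refine finsupp_hom_ext (f := shuffleProd.compr₂ (counit n) (Finsupp.single v 1))
    (g := counit n (Finsupp.single v 1) • counit n) (fun w => ?_) y |>.trans (mul_comm _ _)
  cases v with
  | nil => simp [shuffleProd_one_left]
  | cons a v =>
    cases w with
    | nil => simp [shuffleProd_one_right]
    | cons b w =>
      rw [LinearMap.compr₂_apply, ← consWord_single, ← consWord_single, shuffleProd_consWord]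
      simp [counit, consWord_apply_nil]

theorem forestHom_nil (g : OF n →ₗ[ℝ] ℝ) (hg : g (Finsupp.single [] 1) = 1) :
    forestHom g (Finsupp.single [] 1) = Finsupp.single [] 1 := by
  simp [forestHom, cutHom_single, splitSum, hg, substList]

theorem IsForestCharacter.comp {g h : OF n →ₗ[ℝ] ℝ} (hg : IsForestCharacter g)
    (hh : IsForestCharacter h) : IsForestCharacter (g ∘ₗ forestHom h) := by
  refine ⟨by simp [forestHom_nil h hh.1, hg.1], fun x y => ?_⟩
  simp only [LinearMap.comp_apply, forestHom, cutHom_shuffleProd hh.2, hg.2]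

/-- The inverse is `counit ∘ (forestHom g)⁻¹`. It is multiplicative because `forestHom g` is a
multiplicative bijection and the counit is a character. -/
theorem IsForestCharacter.exists_inverse {g : OF n →ₗ[ℝ] ℝ} (hg : IsForestCharacter g) :
    ∃ h, IsForestCharacter h ∧ g ∘ₗ forestHom h = counit n ∧ h ∘ₗ forestHom g = counit n := by
  let e := LinearEquiv.ofBijective (forestHom g) (forestHom_bijective hg.1)
  have he : ∀ x, e x = forestHom g x := fun _ => rfl
  have he' : ∀ x, e.symm (forestHom g x) = x := fun x => e.symm_apply_apply x
  have h1 : (counit n ∘ₗ e.symm.toLinearMap) ∘ₗ forestHom g = counit n := by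
    refine LinearMap.ext fun x => ?_
    simp [he']
  have h2 : ∀ x, forestHom (counit n ∘ₗ e.symm.toLinearMap) (forestHom g x) = x := by
    intro x
    rw [forestHom_forestHom, h1, forestHom_counit]
  refine ⟨counit n ∘ₗ e.symm.toLinearMap, ⟨?_, ?_⟩, ?_, h1⟩
  · have := he' (Finsupp.single [] 1)
    rw [forestHom_nil g hg.1] at this
    simp [this]
  · intro x y
    obtain ⟨x, rfl⟩ := e.surjective x
    obtain ⟨y, rfl⟩ := e.surjective y
    have := he' (shuffleProd x y)
    rw [forestHom, cutHom_shuffleProd hg.2] at this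
    simp only [LinearMap.comp_apply, LinearEquiv.coe_coe, LinearEquiv.symm_apply_apply]
    rw [he, he, forestHom, this, isForestCharacter_counit.2]
  -- By surjectivity it suffices to test on `forestHom g x`, where both sides equal `g x`.
  · refine LinearMap.ext fun x => ?_
    obtain ⟨x, rfl⟩ := e.surjective x
    rw [LinearMap.comp_apply, he, h2]
    exact (LinearMap.congr_fun (counit_comp_forestHom g) x).symm

/-- A character that is idempotent for the convolution product is the counit. -/
theorem eq_counit_of_comp_forestHom_eq {g : OF n →ₗ[ℝ] ℝ} (h1 : g (Finsupp.single [] 1) = 1)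
    (hg : g ∘ₗ forestHom g = g) : g = counit n := by
  -- The composition law makes `forestHom g` idempotent; being injective, it is the identity.
  have h : ∀ x, forestHom g x = x := fun x =>
    (forestHom_bijective h1).1 (by rw [forestHom_forestHom, hg])
  rw [← counit_comp_forestHom g]
  exact LinearMap.ext fun x => congrArg (counit n) (h x)

/-- The link between the coproduct, which contains `P^c`, and the operators `forestHom`, which
contain a product of values. Only here do the operators need `g` to be a character. -/
theorem IsForestCharacter.listSum_shuffleAll {g : OF n →ₗ[ℝ] ℝ} (hg : IsForestCharacter g)
    (P : List (List (VTree n))) : g (listSum (shuffleAll P)) = cutWeight g P := by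
  induction P with
  | nil => simpa [shuffleAll, listSum, cutWeight] using hg.1
  | cons w P ih =>
    have h : listSum (shuffleAll (w :: P)) =
        shuffleProd (Finsupp.single w 1) (listSum (shuffleAll P)) := by
      rw [map_listSum]
      simp only [shuffleProd_single]
      simp only [shuffleAll]
      generalize shuffleAll P = l
      induction l with
      | nil => rfl
      | cons v l ih => simp [listSum_append, ih]
    rw [h, hg.2, ih]
    simp [cutWeight]

end VTree

/-! ### The operators `Γ_g` on `PB` -/

section Glue
variable {n : ℕ}

theorem list_map_shuffles {β β' : Type*} (f : β → β') (v w : List β) :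
    shuffles (v.map f) (w.map f) = (shuffles v w).map (List.map f) := by
  induction v generalizing w with
  | nil => simp [shuffles_nil_left]
  | cons a v ihv =>
    induction w with
    | nil => simp [shuffles_nil_right]
    | cons b w ihw =>
      simp only [List.map_cons] at ihw ⊢
      rw [shuffles_cons_cons, shuffles_cons_cons, ihw, ← List.map_cons, ihv]
      simp [Function.comp_def]

theorem ETree.ofVList_eq_map (ts : List (VTree n)) :
    ETree.ofVList ts = ts.map fun t => (0, ETree.ofV t) := by
  induction ts with
  | nil => rfl
  | cons t ts ih => simp [ETree.ofVList, ih]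

theorem PBTree.bPlus_map_phi (w : List (VTree n)) :
    PBTree.bPlus (w.map phi) = phi (VTree.node 0 w) := by
  apply Subtype.ext
  simp [PBTree.bPlus, phi, ETree.ofV, ETree.ofVList_eq_map, Function.comp_def]

theorem PBTree.hasDecoratedRoot_phi_node (c : Fin (n + 1)) (w : List (VTree n)) :
    (phi (VTree.node c w)).HasDecoratedRoot ↔ c ≠ 0 := by
  constructor
  · rintro h rfl
    rw [← PBTree.bPlus_map_phi] at h
    exact PBTree.not_hasDecoratedRoot_bPlus _ h
  · intro hc
    refine ⟨(c, ETree.node []), ?_, hc⟩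
    simp [phi, ETree.ofV, ETree.branches, hc]

theorem bPlusPhi_single (w : List (VTree n)) (r : ℝ) :
    bPlusPhi n (Finsupp.single w r) = Finsupp.single (phi (VTree.node 0 w)) r := by
  simp [bPlusPhi, PBTree.bPlus_map_phi]

theorem phiInvBMinus_bPlusPhiPlus (x : OF n) : phiInvBMinus n (bPlusPhiPlus n x) = x :=
  finsupp_hom_ext (f := phiInvBMinus n ∘ₗ bPlusPhiPlus n) (g := LinearMap.id)
    (fun w => by
      simp [phiInvBMinus, bPlusPhiPlus, PlusTree.bPlus, PBTree.bMinus_bPlus, Function.comp_def]) x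

theorem bPlusPhiPlus_phiInvBMinus (x : PBPlus n) : bPlusPhiPlus n (phiInvBMinus n x) = x :=
  finsupp_hom_ext (f := bPlusPhiPlus n ∘ₗ phiInvBMinus n) (g := LinearMap.id)
    (fun t => by
      simp [phiInvBMinus, bPlusPhiPlus, PlusTree.bPlus, PBTree.bPlus_bMinus _ t.2,
        Function.comp_def]) x

/-- `B₊ ∘ φ` is an algebra isomorphism, so characters of `PB₊` and characters of the shuffle algebra
of forests are the same thing. -/
theorem bPlusPhiPlus_shuffleProd (x y : OF n) :
    bPlusPhiPlus n (shuffleProd x y) =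
      PlusTree.treeProd (bPlusPhiPlus n x) (bPlusPhiPlus n y) := by
  refine finsupp_hom_ext (f := (shuffleProd.compr₂ (bPlusPhiPlus n)).flip y)
    (g := (PlusTree.treeProd.compl₁₂ (bPlusPhiPlus n) (bPlusPhiPlus n)).flip y) (fun v => ?_) x
  refine finsupp_hom_ext (f := shuffleProd.compr₂ (bPlusPhiPlus n) (Finsupp.single v 1))
    (g := PlusTree.treeProd.compl₁₂ (bPlusPhiPlus n) (bPlusPhiPlus n) (Finsupp.single v 1))
    (fun w => ?_) y
  rw [LinearMap.compr₂_apply, shuffleProd_single, map_listSum]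
  simp [bPlusPhiPlus, PlusTree.treeProd, PlusTree.bPlus, PBTree.bMinus_bPlus, list_map_shuffles,
    listSum, Function.comp_def]

theorem bPlusPhiPlus_single_nil :
    bPlusPhiPlus n (Finsupp.single [] 1) = Finsupp.single PlusTree.bullet 1 := by
  simp [bPlusPhiPlus, PlusTree.bullet]

theorem IsCharacter.forestCharacter {g : PBPlus n →ₗ[ℝ] ℝ} (hg : IsCharacter g) :
    VTree.IsForestCharacter (g ∘ₗ bPlusPhiPlus n) :=
  ⟨by rw [LinearMap.comp_apply, bPlusPhiPlus_single_nil, hg.1], fun x y => by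
    simp only [LinearMap.comp_apply, bPlusPhiPlus_shuffleProd, hg.2]⟩

theorem VTree.IsForestCharacter.isCharacter {g : OF n →ₗ[ℝ] ℝ} (hg : VTree.IsForestCharacter g) :
    IsCharacter (g ∘ₗ phiInvBMinus n) := by
  constructor
  · rw [← bPlusPhiPlus_single_nil, LinearMap.comp_apply, phiInvBMinus_bPlusPhiPlus, hg.1]
  · intro x y
    have h := bPlusPhiPlus_shuffleProd (phiInvBMinus n x) (phiInvBMinus n y)
    rw [bPlusPhiPlus_phiInvBMinus, bPlusPhiPlus_phiInvBMinus] at h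
    rw [← h, LinearMap.comp_apply, phiInvBMinus_bPlusPhiPlus, hg.2]
    rfl

theorem comp_phiInvBMinus_comp_bPlusPhiPlus (g : OF n →ₗ[ℝ] ℝ) :
    (g ∘ₗ phiInvBMinus n) ∘ₗ bPlusPhiPlus n = g :=
  LinearMap.ext fun x => congrArg g (phiInvBMinus_bPlusPhiPlus x)

/-- The linear bijection between the span of the vertex-decorated trees and `PB`. -/
noncomputable def phiLin (n : ℕ) : (VTree n →₀ ℝ) ≃ₗ[ℝ] PB n := Finsupp.domLCongr phi

@[simp]
theorem phiLin_single (t : VTree n) (r : ℝ) :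
    phiLin n (Finsupp.single t r) = Finsupp.single (phi t) r := by
  simp [phiLin]

theorem mkwCoproduct_single (w : List (VTree n)) :
    mkwCoproduct n (Finsupp.single w 1) = ((VTree.forestCuts w).map fun c =>
      listSum (shuffleAll c.1) ⊗ₜ[ℝ] Finsupp.single c.2 (1 : ℝ)).sum := by
  simp [mkwCoproduct]

theorem deltaPlusPlain_phi_node (w : List (VTree n)) :
    deltaPlusPlain n (phi (VTree.node 0 w)) =
      ((VTree.forestCuts w).map fun c => bPlusPhiPlus n (listSum (shuffleAll c.1)) ⊗ₜ[ℝ]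
        Finsupp.single (phi (VTree.node 0 c.2)) (1 : ℝ)).sum := by
  have h : (PBTree.bMinus (phi (VTree.node 0 w))).map phi.symm = w := by
    rw [← PBTree.bPlus_map_phi, PBTree.bMinus_bPlus]
    simp [Function.comp_def]
  rw [deltaPlusPlain, h, mkwCoproduct_single, map_list_sum, List.map_map]
  simp [Function.comp_def, bPlusPhi_single]

/-- Either the single edge at the root of `B₊` is kept, with nothing cut there, or it is cut and the
trunk is trivial. -/
theorem forestCuts_singleton (c : Fin (n + 1)) (w : List (VTree n)) :
    VTree.forestCuts [VTree.node c w] =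
      ((VTree.forestCuts w).map fun p => ([] :: p.1, [VTree.node c p.2])) ++
        [([[VTree.node c w]], [])] := by
  simp [VTree.forestCuts, VTree.prefixCuts, VTree.keepCuts, VTree.treeCuts, List.flatMap_map]
  rw [List.map_eq_flatMap]

theorem bMinusTree_single_phi_singleton (t : VTree n) :
    bMinusTree n (Finsupp.single (phi (VTree.node 0 [t])) 1) = Finsupp.single (phi t) 1 := by
  have h : ¬ (phi (VTree.node 0 [t])).HasDecoratedRoot := by
    simp [PBTree.hasDecoratedRoot_phi_node]
  have h' : PBTree.bMinus (phi (VTree.node 0 [t])) = [phi t] := by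
    rw [← PBTree.bPlus_map_phi, PBTree.bMinus_bPlus]
    rfl
  simp [bMinusTree, bMinusForest, forestToTree, h, h']

theorem shuffleAll_nil_cons {β : Type*} (P : List (List β)) :
    shuffleAll ([] :: P) = shuffleAll P := by
  rw [shuffleAll]
  simp [funext shuffles_nil_left]

theorem shuffleAll_singleton {β : Type*} (w : List β) : shuffleAll [w] = [w] := by
  simp [shuffleAll, shuffles_nil_right]

/-- The coaction on an arbitrary basis tree, in terms of the cuts of a forest. -/
theorem deltaPlus_single_phi_node (c : Fin (n + 1)) (w : List (VTree n)) :
    deltaPlus n (Finsupp.single (phi (VTree.node c w)) 1) =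
      ((VTree.forestCuts w).map fun p => bPlusPhiPlus n (listSum (shuffleAll p.1)) ⊗ₜ[ℝ]
        Finsupp.single (phi (VTree.node c p.2)) (1 : ℝ)).sum := by
  by_cases hc : c = 0
  · subst hc
    simp [deltaPlus, PBTree.hasDecoratedRoot_phi_node, deltaPlusPlain_phi_node]
  · have e : PBTree.bPlus [phi (VTree.node c w)] = phi (VTree.node 0 [VTree.node c w]) :=
      PBTree.bPlus_map_phi [VTree.node c w]
    have e1 : (Finsupp.single (PlusTree.bPlus [phi (VTree.node c w)]) 1 : PBPlus n) =
        bPlusPhiPlus n (listSum (shuffleAll [[VTree.node c w]])) := by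
      simp [shuffleAll_singleton, listSum, bPlusPhiPlus]
    have e2 : (PBTree.bullet : PBTree n) = phi (VTree.node 0 []) := PBTree.bPlus_map_phi []
    rw [deltaPlus, Finsupp.linearCombination_single, one_smul,
      if_pos ((PBTree.hasDecoratedRoot_phi_node c w).2 hc), e, deltaPlusPlain_phi_node,
      forestCuts_singleton, e1, e2, List.map_append, List.sum_append, List.map_singleton,
      List.sum_singleton]
    -- The subtracted term `B₊(τ) ⊗ •` is the cut of the only root edge. Once it cancels, every
    -- remaining trunk is a single tree and `B₋` is meaningful.
    have hsub : ∀ x y : PBPlus n ⊗[ℝ] PB n, x + y - y = x :=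
      fun x y => add_sub_cancel_right x y
    refine (congrArg _ (hsub _ _)).trans ?_
    rw [List.map_map, map_list_sum, List.map_map]
    congr 1
    refine List.map_congr_left fun p _ => ?_
    simp [shuffleAll_nil_cons, bMinusTree_single_phi_singleton]

/-- `Γ_g` is the cutting operator of the character `g`. -/
theorem gammaOf_phiLin {g : PBPlus n →ₗ[ℝ] ℝ} (hg : IsCharacter g) (x : VTree n →₀ ℝ) :
    gammaOf g (phiLin n x) = phiLin n (VTree.treeHom (g ∘ₗ bPlusPhiPlus n) x) := by
  refine finsupp_hom_ext (f := gammaOf g ∘ₗ (phiLin n).toLinearMap)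
    (g := (phiLin n).toLinearMap ∘ₗ VTree.treeHom (g ∘ₗ bPlusPhiPlus n)) (fun t => ?_) x
  obtain ⟨c, w⟩ := t
  simp only [LinearMap.comp_apply, LinearEquiv.coe_coe, phiLin_single, VTree.treeHom_single,
    gammaOf, deltaPlus_single_phi_node]
  rw [VTree.treeMap_node, VTree.forestHom_single]
  simp only [map_list_sum, List.map_map]
  congr 1
  refine List.map_congr_left fun p _ => ?_
  have h := hg.forestCharacter.listSum_shuffleAll p.1
  rw [LinearMap.comp_apply] at h
  simp [h]

theorem gammaOf_comp_phiInvBMinus {g : OF n →ₗ[ℝ] ℝ} (hg : VTree.IsForestCharacter g)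
    (x : VTree n →₀ ℝ) :
    gammaOf (g ∘ₗ phiInvBMinus n) (phiLin n x) = phiLin n (VTree.treeHom g x) := by
  rw [gammaOf_phiLin hg.isCharacter, comp_phiInvBMinus_comp_bPlusPhiPlus]

/-- Transports the group axioms for `𝒢` to convolution of forest characters. -/
theorem mem_structureGroup_iff (Γ : PB n →ₗ[ℝ] PB n) :
    Γ ∈ structureGroup n ↔ ∃ g, VTree.IsForestCharacter g ∧
      ∀ x, Γ (phiLin n x) = phiLin n (VTree.treeHom g x) := by
  constructor
  · rintro ⟨g, hg, rfl⟩
    exact ⟨_, hg.forestCharacter, gammaOf_phiLin hg⟩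
  · rintro ⟨g, hg, h⟩
    refine ⟨_, hg.isCharacter, LinearMap.ext fun v => ?_⟩
    obtain ⟨x, rfl⟩ := (phiLin n).surjective v
    rw [h, gammaOf_comp_phiInvBMinus hg]

theorem id_mem_structureGroup : LinearMap.id ∈ structureGroup n :=
  (mem_structureGroup_iff _).2 ⟨_, VTree.isForestCharacter_counit, fun x => by
    rw [VTree.treeHom_counit, LinearMap.id_apply]⟩

theorem comp_mem_structureGroup {Γ Γ' : PB n →ₗ[ℝ] PB n} (h : Γ ∈ structureGroup n)
    (h' : Γ' ∈ structureGroup n) : Γ ∘ₗ Γ' ∈ structureGroup n := by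
  rw [mem_structureGroup_iff] at h h' ⊢
  obtain ⟨g, hg, h⟩ := h
  obtain ⟨g', hg', h'⟩ := h'
  exact ⟨_, hg.comp hg', fun x => by rw [LinearMap.comp_apply, h', h, VTree.treeHom_treeHom]⟩

theorem exists_inverse_mem_structureGroup {Γ : PB n →ₗ[ℝ] PB n} (h : Γ ∈ structureGroup n) :
    ∃ Γ' ∈ structureGroup n, Γ ∘ₗ Γ' = LinearMap.id ∧ Γ' ∘ₗ Γ = LinearMap.id := by
  obtain ⟨g, hg, h⟩ := (mem_structureGroup_iff _).1 h
  obtain ⟨g', hg', h1, h2⟩ := hg.exists_inverse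
  refine ⟨_, ⟨_, hg'.isCharacter, rfl⟩, ?_, ?_⟩
  all_goals
    refine LinearMap.ext fun v => ?_
    obtain ⟨x, rfl⟩ := (phiLin n).surjective v
    rw [LinearMap.comp_apply]
  · rw [gammaOf_comp_phiInvBMinus hg', h, VTree.treeHom_treeHom, h1, VTree.treeHom_counit]
    rfl
  · rw [h, gammaOf_comp_phiInvBMinus hg', VTree.treeHom_treeHom, h2, VTree.treeHom_counit]
    rfl

end Glue

/-! ### The grading of `PB` -/

section Grading
variable {n : ℕ}

/-- The weights of the vertices: `1` for the decoration `0` and `α i` for `i ≠ 0`. -/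
noncomputable def vertexWeight (α : Fin n → ℝ) : Fin (n + 1) → ℝ := Fin.cases 1 α

@[simp]
theorem vertexWeight_zero (α : Fin n → ℝ) : vertexWeight α 0 = 1 := rfl

@[simp]
theorem vertexWeight_succ (α : Fin n → ℝ) (i : Fin n) : vertexWeight α i.succ = α i := rfl

theorem vertexWeight_pos {α : Fin n → ℝ} (hα : ∀ i, 0 < α i) (c : Fin (n + 1)) :
    0 < vertexWeight α c := by
  cases c using Fin.cases with
  | zero => exact one_pos
  | succ i => exact hα i

theorem ETree.degList_append (α : Fin n → ℝ) (bs cs : List (Fin (n + 1) × ETree n)) :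
    ETree.degList α (bs ++ cs) = ETree.degList α bs + ETree.degList α cs := by
  induction bs with
  | nil => simp [ETree.degList]
  | cons p bs ih =>
    obtain ⟨d, t⟩ := p
    simp [ETree.degList, ih, add_assoc]

/-- Each vertex is charged with the edge leading to it and its own decorated edge: `1` for
decoration `0`, and `1 + (α i - 1) = α i` otherwise. The root has no incoming edge, which explains
the `-1`. -/
theorem PBTree.deg_phi (α : Fin n → ℝ) (t : VTree n) :
    (phi t).deg α = t.wt (vertexWeight α) - 1 := by
  induction t using VTree.inductionOn with
  | h c ts ih =>
    have h : ETree.degList α (ETree.ofVList ts) = VTree.wtList (vertexWeight α) ts := by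
      induction ts with
      | nil => rfl
      | cons t ts ih' =>
        simp only [List.forall_mem_cons] at ih
        have h1 : (ETree.ofV t).deg α = t.wt (vertexWeight α) - 1 := ih.1
        simp only [ETree.ofVList, ETree.degList, VTree.wtList, h1, ih' ih.2, ETree.edgeDeg,
          Fin.cases_zero]
        ring
    change ETree.deg α (ETree.ofV (VTree.node c ts)) = _
    rw [ETree.ofV, ETree.deg, ETree.degList_append, h, VTree.wt]
    cases c using Fin.cases with
    | zero => simp [ETree.degList]
    | succ i =>
      simp [ETree.degList, ETree.deg, ETree.edgeDeg, Fin.succ_ne_zero]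
      ring

theorem VTree.wt_node_eq {α : Fin n → ℝ} {c : Fin (n + 1)} {w : List (VTree n)}
    (h : ∃ (k₀ : ℕ) (k : Fin n → ℕ),
      wtList (vertexWeight α) w = k₀ + ∑ i, (k i : ℝ) * α i) :
    ∃ (k₀ : ℕ) (k : Fin n → ℕ),
      wt (vertexWeight α) (node c w) = k₀ + ∑ i, (k i : ℝ) * α i := by
  obtain ⟨k₀, k, h⟩ := h
  cases c using Fin.cases with
  | zero =>
    refine ⟨k₀ + 1, k, ?_⟩
    rw [wt, h, vertexWeight_zero]
    push_cast
    ring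
  | succ j =>
    refine ⟨k₀, k + Pi.single j 1, ?_⟩
    rw [wt, h, vertexWeight_succ]
    simp only [Pi.add_apply, Nat.cast_add, add_mul, Finset.sum_add_distrib]
    have : ∑ i, ((Pi.single j 1 : Fin n → ℕ) i : ℝ) * α i = α j := by
      simp [Pi.single_apply]
    rw [this]
    ring

theorem VTree.wtList_eq_of_forall {α : Fin n → ℝ} {w : List (VTree n)}
    (h : ∀ t ∈ w, ∃ (k₀ : ℕ) (k : Fin n → ℕ),
      wt (vertexWeight α) t = k₀ + ∑ i, (k i : ℝ) * α i) :
    ∃ (k₀ : ℕ) (k : Fin n → ℕ),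
      wtList (vertexWeight α) w = k₀ + ∑ i, (k i : ℝ) * α i := by
  induction w with
  | nil => exact ⟨0, 0, by simp [wtList]⟩
  | cons t w ih =>
    simp only [List.forall_mem_cons] at h
    obtain ⟨k₀, k, h1⟩ := h.1
    obtain ⟨l₀, l, h2⟩ := ih h.2
    refine ⟨k₀ + l₀, k + l, ?_⟩
    rw [wtList, h1, h2]
    simp only [Pi.add_apply, Nat.cast_add, add_mul, Finset.sum_add_distrib]
    ring

theorem VTree.exists_wt_eq (α : Fin n → ℝ) (t : VTree n) :
    ∃ (k₀ : ℕ) (k : Fin n → ℕ), wt (vertexWeight α) t = k₀ + ∑ i, (k i : ℝ) * α i := by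
  induction t using VTree.inductionOn with
  | h c w ih => exact wt_node_eq (wtList_eq_of_forall ih)

theorem PBTree.deg_mem_indexSet (α : Fin n → ℝ) (t : PBTree n) : t.deg α ∈ indexSet α := by
  obtain ⟨t, rfl⟩ := phi.surjective t
  obtain ⟨k₀, k, h⟩ := t.exists_wt_eq α
  exact ⟨k₀, k, Or.inr (by rw [PBTree.deg_phi, h])⟩

-- Finiteness of the homogeneous components and of the index set

theorem VTree.finite_sizeList_le (N : ℕ) : {w : List (VTree n) | sizeList w ≤ N}.Finite := by
  induction N with
  | zero =>
    refine (Set.finite_singleton []).subset fun w hw => ?_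
    rw [Set.mem_ofPred_eq] at hw
    by_contra h
    exact absurd (sizeList_pos h) (by omega)
  | succ N ih =>
    -- A nonempty forest is determined by the decoration of its first root, the branches there and
    -- the remaining trees; the root takes one vertex, so both forests have at most `N`.
    refine ((Set.finite_singleton []).union (((Set.finite_univ (α := Fin (n + 1))).prod
      (ih.prod ih)).image fun p => node p.1 p.2.1 :: p.2.2)).subset fun w hw => ?_
    rw [Set.mem_ofPred_eq] at hw
    match w with
    | [] => exact Or.inl rfl
    | node c u :: v =>
      simp only [sizeList, size] at hw
      refine Or.inr ⟨(c, u, v), ⟨Set.mem_univ _, ?_, ?_⟩, rfl⟩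
      · change sizeList u ≤ N
        omega
      · change sizeList v ≤ N
        omega

theorem VTree.mul_size_le_wt {a : Fin (n + 1) → ℝ} {m : ℝ} (h : ∀ c, m ≤ a c) (t : VTree n) :
    m * size t ≤ wt a t := by
  induction t using inductionOn with
  | h c ts ih =>
    have h' : m * sizeList ts ≤ wtList a ts := by
      induction ts with
      | nil => simp [sizeList, wtList]
      | cons t ts ih' =>
        simp only [List.forall_mem_cons] at ih
        have := ih' ih.2
        simp only [sizeList, wtList]
        push_cast
        linarith [ih.1]
    simp only [size, wt]
    push_cast
    linarith [h c]

theorem exists_pos_le_vertexWeight {α : Fin n → ℝ} (hα : ∀ i, 0 < α i) :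
    ∃ m, 0 < m ∧ ∀ c, m ≤ vertexWeight α c := by
  obtain ⟨c, hc⟩ := Finite.exists_min (vertexWeight α)
  exact ⟨_, vertexWeight_pos hα c, hc⟩

/-- A tree of degree `a` has weight `a + 1`, hence at most `(a + 1) / m` vertices, `m` being the
least vertex weight. -/
theorem finite_deg_eq {α : Fin n → ℝ} (hα : ∀ i, 0 < α i) (a : ℝ) :
    {t : PBTree n | t.deg α = a}.Finite := by
  obtain ⟨m, hm, h⟩ := exists_pos_le_vertexWeight hα
  obtain ⟨N, hN⟩ := exists_nat_ge ((a + 1) / m)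
  refine ((VTree.finite_sizeList_le (n := n) N).preimage
    (f := fun t : PBTree n => [phi.symm t]) fun s _ t _ h => ?_).subset fun t ht => ?_
  · simpa using h
  · obtain ⟨t, rfl⟩ := phi.surjective t
    rw [Set.mem_ofPred_eq, PBTree.deg_phi] at ht
    have h1 := VTree.mul_size_le_wt h t
    have h2 : (VTree.size t : ℝ) ≤ N := by
      refine le_trans ?_ hN
      rw [le_div_iff₀ hm]
      linarith
    simpa [VTree.sizeList] using h2

theorem finiteDimensional_homogeneous {α : Fin n → ℝ} (hα : ∀ i, 0 < α i) (a : ℝ) :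
    FiniteDimensional ℝ (homogeneous α a) := by
  have := (finite_deg_eq hα a).to_subtype
  exact Module.Finite.equiv (Finsupp.supportedEquivFinsupp (M := ℝ) (R := ℝ)
    {t : PBTree n | t.deg α = a}).symm

theorem finite_indexSet_inter_Icc {α : Fin n → ℝ} (hα : ∀ i, 0 < α i) (a b : ℝ) :
    (indexSet α ∩ Set.Icc a b).Finite := by
  obtain ⟨m, hm, h⟩ := exists_pos_le_vertexWeight hα
  obtain ⟨N, hN⟩ := exists_nat_ge ((b + 1) / m)
  have hfin : (Set.Icc 0 ((N, fun _ => N) : ℕ × (Fin n → ℕ))).Finite := by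
    classical exact Set.finite_Icc _ _
  refine ((hfin.image fun p => (p.1 : ℝ) + ∑ i, (p.2 i : ℝ) * α i).union
    (hfin.image fun p => (p.1 : ℝ) + ∑ i, (p.2 i : ℝ) * α i - 1)).subset ?_
  rintro x ⟨⟨k₀, k, hx⟩, -, hxb⟩
  -- The bound `b + 1` covers both kinds of indices, and each multiplicity is then at most `(b + 1)
  -- / m`.
  have hs : (k₀ : ℝ) + ∑ i, (k i : ℝ) * α i ≤ b + 1 := by
    rcases hx with rfl | rfl <;> linarith
  have hnn : ∀ i, 0 ≤ (k i : ℝ) * α i := fun i => mul_nonneg (Nat.cast_nonneg _) (hα i).le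
  have hle : ∀ l : ℕ, (l : ℝ) * m ≤ b + 1 → l ≤ N := by
    intro l hl
    rw [← le_div_iff₀ hm] at hl
    exact_mod_cast hl.trans hN
  have hk : (k₀, k) ≤ ((N, fun _ => N) : ℕ × (Fin n → ℕ)) := by
    refine ⟨hle k₀ ?_, fun i => hle (k i) ?_⟩
    · have h0 := mul_le_mul_of_nonneg_left (h 0) (Nat.cast_nonneg (α := ℝ) k₀)
      rw [vertexWeight_zero] at h0
      linarith [Finset.sum_nonneg fun i (_ : i ∈ Finset.univ) => hnn i]
    · have h1 := mul_le_mul_of_nonneg_left (h i.succ) (Nat.cast_nonneg (α := ℝ) (k i))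
      rw [vertexWeight_succ] at h1
      linarith [Finset.single_le_sum (fun i _ => hnn i) (Finset.mem_univ i),
        Nat.cast_nonneg (α := ℝ) k₀]
  rcases hx with rfl | rfl
  · exact Or.inl ⟨(k₀, k), ⟨zero_le, hk⟩, rfl⟩
  · exact Or.inr ⟨(k₀, k), ⟨zero_le, hk⟩, rfl⟩

-- The decomposition by degree and the action of the structure group

theorem single_mem_iSup_homogeneous (α : Fin n → ℝ) (p : ℝ → Prop) {t : PBTree n}
    (ht : p (t.deg α)) (r : ℝ) :
    Finsupp.single t r ∈ ⨆ b : {b // b ∈ indexSet α ∧ p b}, homogeneous α b :=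
  Submodule.mem_iSup_of_mem (p := fun b : {b // b ∈ indexSet α ∧ p b} => homogeneous α b)
    ⟨t.deg α, t.deg_mem_indexSet α, ht⟩ (Finsupp.single_mem_supported ℝ r rfl)

theorem supported_deg_le_iSup (α : Fin n → ℝ) (p : ℝ → Prop) :
    (Finsupp.supported ℝ ℝ {t : PBTree n | p (t.deg α)} : Submodule ℝ (PB n)) ≤
      ⨆ b : {b // b ∈ indexSet α ∧ p b}, homogeneous α b := by
  rw [Finsupp.supported_eq_span_single, Submodule.span_le]
  rintro _ ⟨t, ht, rfl⟩
  exact single_mem_iSup_homogeneous α p ht 1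

theorem iSup_homogeneous (α : Fin n → ℝ) : ⨆ a : indexSet α, homogeneous α a = ⊤ := by
  refine eq_top_iff.2 fun v _ => ?_
  induction v using Finsupp.induction_linear with
  | zero => exact zero_mem _
  | add v w hv hw => exact add_mem (hv trivial) (hw trivial)
  | single t r =>
    exact Submodule.mem_iSup_of_mem (p := fun b : indexSet α => homogeneous α b)
      ⟨t.deg α, t.deg_mem_indexSet α⟩ (Finsupp.single_mem_supported ℝ r rfl)

theorem iSupIndep_homogeneous (α : Fin n → ℝ) :
    iSupIndep fun a : indexSet α => homogeneous α a := by
  intro a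
  refine Disjoint.mono_right (c := (Finsupp.supported ℝ ℝ {t : PBTree n | t.deg α ≠ a})) ?_ ?_
  · refine iSup₂_le fun b hb => Finsupp.supported_mono fun t ht => ?_
    rw [Set.mem_ofPred_eq] at ht ⊢
    rw [ht]
    exact fun h => hb (Subtype.ext h)
  · refine Finsupp.disjoint_supported_supported (Set.disjoint_left.2 fun t ht ht' => ?_)
    rw [Set.mem_ofPred_eq] at ht ht'
    exact ht' ht

theorem structureGroup_sub_mem {α : Fin n → ℝ} (hα : ∀ i, 0 < α i) {Γ : PB n →ₗ[ℝ] PB n}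
    (hΓ : Γ ∈ structureGroup n) (a : ℝ) {v : PB n} (hv : v ∈ homogeneous α a) :
    Γ v - v ∈ ⨆ b : {b // b ∈ indexSet α ∧ b < a}, homogeneous α b := by
  obtain ⟨g, hg, h⟩ := (mem_structureGroup_iff _).1 hΓ
  refine supported_deg_le_iSup α (· < a) ?_
  rw [homogeneous, Finsupp.supported_eq_span_single] at hv
  refine Submodule.span_induction
    (p := fun v _ => Γ v - v ∈ Finsupp.supported ℝ ℝ {t : PBTree n | t.deg α < a}) ?_ ?_ ?_ ?_ hv
  · rintro _ ⟨t, ht, rfl⟩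
    obtain ⟨t, rfl⟩ := phi.surjective t
    rw [Set.mem_ofPred_eq, PBTree.deg_phi] at ht
    -- Degree and vertex weight differ by the constant `1` under `φ`, so a loss of weight is a loss
    -- of degree.
    have h1 := VTree.treeMap_sub_single_mem (vertexWeight_pos hα) hg.1 t
    have h2 := Submodule.mem_map_of_mem (f := Finsupp.lmapDomain ℝ ℝ phi) h1
    rw [VTree.lowTrees, Finsupp.lmapDomain_supported] at h2
    have e : Γ (Finsupp.single (phi t) 1) - Finsupp.single (phi t) 1 =
        Finsupp.lmapDomain ℝ ℝ phi (VTree.treeMap g t - Finsupp.single t 1) := by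
      rw [← phiLin_single, h, VTree.treeHom_single, ← map_sub]
      exact Finsupp.domLCongr_apply _ _ |>.trans (Finsupp.equivMapDomain_eq_mapDomain _ _)
    rw [e]
    refine Finsupp.supported_mono ?_ h2
    rintro _ ⟨s, hs, rfl⟩
    rw [Set.mem_ofPred_eq] at hs ⊢
    rw [PBTree.deg_phi]
    linarith
  · simp
  · intro x y _ _ h1 h2
    simpa [add_sub_add_comm] using add_mem h1 h2
  · intro r x _ h1
    simpa [smul_sub] using Submodule.smul_mem _ r h1

theorem PBTree.bullet_eq_phi : (PBTree.bullet : PBTree n) = phi (VTree.node 0 []) :=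
  PBTree.bPlus_map_phi []

theorem isPreRegularityStructure_PB {α : Fin n → ℝ} (hα : ∀ i, 0 < α i) :
    IsPreRegularityStructure (indexSet α) (homogeneous α)
      (Finsupp.single PBTree.bullet 1) (structureGroup n) where
  bddBelow := by
    refine ⟨-1, ?_⟩
    rintro x ⟨k₀, k, hx⟩
    have h : 0 ≤ ∑ i, (k i : ℝ) * α i :=
      Finset.sum_nonneg fun i _ => mul_nonneg (Nat.cast_nonneg _) (hα i).le
    have h0 : (0 : ℝ) ≤ k₀ := Nat.cast_nonneg _
    rcases hx with rfl | rfl <;> linarith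
  locallyFinite := finite_indexSet_inter_Icc hα
  independent := iSupIndep_homogeneous α
  iSup_eq_top := iSup_homogeneous α
  complete a _ := by
    have := finiteDimensional_homogeneous hα a
    exact FiniteDimensional.complete ℝ (homogeneous α a)
  zero_mem := ⟨0, 0, Or.inl (by simp)⟩
  one_mem := Finsupp.single_mem_supported ℝ 1 (by
    rw [Set.mem_ofPred_eq, PBTree.bullet_eq_phi, PBTree.deg_phi]
    simp [VTree.wt, VTree.wtList])
  one_ne_zero := by simp
  id_mem := id_mem_structureGroup
  comp_mem _ h _ h' := comp_mem_structureGroup h h'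
  inv_mem _ h := exists_inverse_mem_structureGroup h
  sub_mem _ h a _ _ hv := structureGroup_sub_mem hα h a hv

-- The component of degree zero

theorem exists_forest_of_leaves (α : Fin n → ℝ) (k : Fin n → ℕ) :
    ∃ w : List (VTree n), VTree.wtList (vertexWeight α) w = ∑ i, (k i : ℝ) * α i ∧
      ∀ t ∈ w, ∃ i : Fin n, t = VTree.node i.succ [] := by
  refine ⟨(List.finRange n).flatMap fun i => List.replicate (k i) (VTree.node i.succ []), ?_, ?_⟩
  · rw [VTree.wtList_eq_sum, List.map_flatMap, List.flatMap_def, List.sum_flatten, List.map_map,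
      ← List.ofFn_eq_map, List.sum_ofFn]
    simp [VTree.wt, VTree.wtList]
  · intro t ht
    simp only [List.mem_flatMap] at ht
    obtain ⟨i, -, hi⟩ := ht
    exact ⟨i, List.eq_of_mem_replicate hi⟩

/-- Degree zero means total vertex weight one. An undecorated root exhausts this weight and leaves
only `•`; a root with decoration `i ≠ 0` leaves no room for a vertex of decoration `0`, so the
weight is a sum of the `α i`. -/
theorem homogeneous_zero_eq_span_iff {α : Fin n → ℝ} (hα : ∀ i, 0 < α i) :
    homogeneous α 0 = Submodule.span ℝ {Finsupp.single PBTree.bullet 1} ↔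
      ∀ k : Fin n → ℕ, ∑ i, (k i : ℝ) * α i ≠ 1 := by
  constructor
  · intro h k hk
    obtain ⟨w, hw, hleaf⟩ := exists_forest_of_leaves α k
    rw [hk] at hw
    cases w with
    | nil => simp [VTree.wtList] at hw
    | cons t w =>
      obtain ⟨i, rfl⟩ := hleaf t (by simp)
      -- Hanging the other leaves from the first one keeps the total weight equal to `1` and gives a
      -- tree of degree zero with decorated root.
      have hdeg : (phi (VTree.node i.succ w)).deg α = 0 := by
        rw [PBTree.deg_phi]
        simp only [VTree.wtList, VTree.wt] at hw ⊢
        linarith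
      have hmem : (Finsupp.single (phi (VTree.node i.succ w)) 1 : PB n) ∈ homogeneous α 0 :=
        Finsupp.single_mem_supported ℝ 1 hdeg
      rw [h, Submodule.mem_span_singleton] at hmem
      obtain ⟨r, hr⟩ := hmem
      have hne : PBTree.bullet ≠ phi (VTree.node i.succ w) := by
        rw [PBTree.bullet_eq_phi]
        intro he
        have := phi.injective he
        simp only [VTree.node.injEq] at this
        exact Fin.succ_ne_zero i this.1.symm
      have := DFunLike.congr_fun hr (phi (VTree.node i.succ w))
      simp [hne] at this
  · intro h
    have hset : {t : PBTree n | t.deg α = 0} = {PBTree.bullet} := by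
      ext t
      obtain ⟨⟨c, w⟩, rfl⟩ := phi.surjective t
      rw [Set.mem_ofPred_eq, Set.mem_singleton_iff, PBTree.deg_phi, PBTree.bullet_eq_phi,
        phi.injective.eq_iff]
      constructor
      · intro hw
        rw [VTree.wt] at hw
        cases c using Fin.cases with
        | zero =>
          cases w with
          | nil => rfl
          | cons t w =>
            have h1 := VTree.wt_pos (vertexWeight_pos hα) t
            have h2 := VTree.wtList_nonneg fun s (_ : s ∈ w) =>
              (VTree.wt_pos (vertexWeight_pos hα) s).le
            rw [vertexWeight_zero, VTree.wtList] at hw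
            linarith
        | succ j =>
          obtain ⟨k₀, k, hk⟩ := VTree.wtList_eq_of_forall (w := w) fun t _ => t.exists_wt_eq α
          rw [vertexWeight_succ, hk] at hw
          have hs : ∑ i, ((k + Pi.single j 1 : Fin n → ℕ) i : ℝ) * α i =
              ∑ i, (k i : ℝ) * α i + α j := by
            simp only [Pi.add_apply, Nat.cast_add, add_mul, Finset.sum_add_distrib]
            simp [Pi.single_apply]
          -- One vertex of decoration `0` already has weight `1`, and the root adds `α j > 0`.
          have hk0 : k₀ = 0 := by
            by_contra hne
            have h1 : (1 : ℝ) ≤ k₀ := by exact_mod_cast Nat.one_le_iff_ne_zero.2 hne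
            have h2 : 0 ≤ ∑ i, (k i : ℝ) * α i :=
              Finset.sum_nonneg fun i _ => mul_nonneg (Nat.cast_nonneg _) (hα i).le
            linarith [hα j]
          rw [hk0, Nat.cast_zero] at hw
          exact absurd (hs.trans (by linarith)) (h (k + Pi.single j 1))
      · intro he
        simp only [VTree.node.injEq] at he
        simp [he.1, he.2, VTree.wt, VTree.wtList]
    rw [homogeneous, hset, Finsupp.supported_eq_span_single, Set.image_singleton]

theorem isRegularityStructure_PB_iff {α : Fin n → ℝ} (hα : ∀ i, 0 < α i) :
    IsRegularityStructure (indexSet α) (homogeneous α)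
      (Finsupp.single PBTree.bullet 1) (structureGroup n) ↔
        ∀ k : Fin n → ℕ, ∑ i, (k i : ℝ) * α i ≠ 1 :=
  ⟨fun h => (homogeneous_zero_eq_span_iff hα).1 h.T_zero, fun h =>
    { isPreRegularityStructure_PB hα with T_zero := (homogeneous_zero_eq_span_iff hα).2 h }⟩

end Grading

/-! ### Models from regularizations of the path components -/

section AbstractModel
variable {n : ℕ} {D : Type*} [AddCommGroup D] [Module ℝ D]

namespace VTree

/-- The last term is the cut of the whole tree. It is the only discrepancy between cutting `B₊(τ)`
and cutting `τ`. -/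
theorem forestHom_singleton_node {g : OF n →ₗ[ℝ] ℝ} (hg : g (Finsupp.single [] 1) = 1)
    (c : Fin (n + 1)) (w : List (VTree n)) :
    forestHom g (Finsupp.single [node c w] 1) =
      Finsupp.lmapDomain ℝ ℝ (fun v => [node c v]) (forestHom g (Finsupp.single w 1)) +
        g (Finsupp.single [node c w] 1) • Finsupp.single [] 1 := by
  have h : ∀ x : OF n, consWord (Finsupp.lmapDomain ℝ ℝ (node c) x) (Finsupp.single [] 1) =
      Finsupp.lmapDomain ℝ ℝ (fun v => [node c v]) x :=
    finsupp_hom_ext (f := consWord.flip (Finsupp.single [] 1) ∘ₗ Finsupp.lmapDomain ℝ ℝ (node c))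
      (g := Finsupp.lmapDomain ℝ ℝ fun v => [node c v]) fun v => by simp
  rw [← h, ← treeMap_node]
  conv_lhs => rw [forestHom, cutHom_single]
  simp [splitSum, substList, hg]

end VTree

/-- The linear map on `PB` given by `B₊(φ(w)) ↦ R(w)` and by `τ ↦ ∂ R(φ⁻¹(τ))` on the trees `τ`
with a decorated edge at the root. -/
noncomputable def modelMap (R : OF n →ₗ[ℝ] D) (d : D →ₗ[ℝ] D) : PB n →ₗ[ℝ] D :=
  Finsupp.linearCombination ℝ (fun t : VTree n => match t with
    | .node c w => if c = 0 then R (Finsupp.single w 1)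
        else d (R (Finsupp.single [VTree.node c w] 1))) ∘ₗ (phiLin n).symm.toLinearMap

theorem modelMap_phiLin_zero (R : OF n →ₗ[ℝ] D) (d : D →ₗ[ℝ] D) (x : OF n) :
    modelMap R d (phiLin n (Finsupp.lmapDomain ℝ ℝ (VTree.node 0) x)) = R x :=
  finsupp_hom_ext (f := modelMap R d ∘ₗ (phiLin n).toLinearMap ∘ₗ
    Finsupp.lmapDomain ℝ ℝ (VTree.node 0)) (fun w => by
      simp [modelMap, -phiLin_single]) x

theorem modelMap_phiLin_of_ne_zero (R : OF n →ₗ[ℝ] D) (d : D →ₗ[ℝ] D) {c : Fin (n + 1)}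
    (hc : c ≠ 0) (x : OF n) :
    modelMap R d (phiLin n (Finsupp.lmapDomain ℝ ℝ (VTree.node c) x)) =
      d (R (Finsupp.lmapDomain ℝ ℝ (fun v => [VTree.node c v]) x)) :=
  finsupp_hom_ext (f := modelMap R d ∘ₗ (phiLin n).toLinearMap ∘ₗ
    Finsupp.lmapDomain ℝ ℝ (VTree.node c))
    (g := d ∘ₗ R ∘ₗ Finsupp.lmapDomain ℝ ℝ fun v => [VTree.node c v]) (fun w => by
      simp [modelMap, hc, -phiLin_single]) x

theorem modelMap_single_zero (R : OF n →ₗ[ℝ] D) (d : D →ₗ[ℝ] D) (w : List (VTree n)) :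
    modelMap R d (Finsupp.single (phi (VTree.node 0 w)) 1) = R (Finsupp.single w 1) := by
  simpa using modelMap_phiLin_zero R d (Finsupp.single w 1)

theorem modelMap_single_of_ne_zero (R : OF n →ₗ[ℝ] D) (d : D →ₗ[ℝ] D) {c : Fin (n + 1)}
    (hc : c ≠ 0) (w : List (VTree n)) :
    modelMap R d (Finsupp.single (phi (VTree.node c w)) 1) =
      d (R (Finsupp.single [VTree.node c w] 1)) := by
  simpa using modelMap_phiLin_of_ne_zero R d hc (Finsupp.single w 1)

theorem bPlusPhi_singleton (t : VTree n) :
    (Finsupp.single (PBTree.bPlus [phi t]) 1 : PB n) = bPlusPhi n (Finsupp.single [t] 1) := by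
  rw [bPlusPhi_single, ← PBTree.bPlus_map_phi]
  rfl

/-- The relations that characterize `modelMap`. -/
theorem eq_modelMap_iff (R : OF n →ₗ[ℝ] D) (d : D →ₗ[ℝ] D) (P : PB n →ₗ[ℝ] D) :
    P = modelMap R d ↔
      (∀ w, P (bPlusPhi n (Finsupp.single w 1)) = R (Finsupp.single w 1)) ∧
      ∀ τ : PBTree n, τ.HasDecoratedRoot →
        P (Finsupp.single τ 1) = d (P (Finsupp.single (PBTree.bPlus [τ]) 1)) := by
  constructor
  · rintro rfl
    refine ⟨fun w => by rw [bPlusPhi_single, modelMap_single_zero], fun τ hτ => ?_⟩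
    obtain ⟨⟨c, w⟩, rfl⟩ := phi.surjective τ
    rw [bPlusPhi_singleton, bPlusPhi_single, modelMap_single_zero,
      modelMap_single_of_ne_zero R d ((PBTree.hasDecoratedRoot_phi_node c w).1 hτ)]
  · rintro ⟨h1, h2⟩
    refine LinearMap.ext fun v => finsupp_hom_ext (fun τ => ?_) v
    obtain ⟨⟨c, w⟩, rfl⟩ := phi.surjective τ
    by_cases hc : c = 0
    · subst hc
      rw [modelMap_single_zero, ← bPlusPhi_single, h1]
    · rw [modelMap_single_of_ne_zero R d hc,
        h2 _ ((PBTree.hasDecoratedRoot_phi_node c w).2 hc), bPlusPhi_singleton, h1]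

/-- At an undecorated root this is the relation between `R'` and `R`. At a decorated one, the full
cut contributes a multiple of `R(1)`, which `d` annihilates. -/
theorem modelMap_comp_gammaOf (R R' : OF n →ₗ[ℝ] D) (d : D →ₗ[ℝ] D) {g : OF n →ₗ[ℝ] ℝ}
    (hg : VTree.IsForestCharacter g) (hR : ∀ x, R' x = R (VTree.forestHom g x))
    (hd : d (R (Finsupp.single [] 1)) = 0) :
    modelMap R' d = modelMap R d ∘ₗ gammaOf (g ∘ₗ phiInvBMinus n) := by
  refine LinearMap.ext fun v => finsupp_hom_ext (fun τ => ?_) v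
  obtain ⟨⟨c, w⟩, rfl⟩ := phi.surjective τ
  rw [LinearMap.comp_apply, ← phiLin_single, gammaOf_comp_phiInvBMinus hg,
    VTree.treeHom_single, VTree.treeMap_node, phiLin_single]
  by_cases hc : c = 0
  · subst hc
    rw [modelMap_single_zero, modelMap_phiLin_zero, hR]
  · rw [modelMap_single_of_ne_zero R' d hc, modelMap_phiLin_of_ne_zero R d hc, hR,
      VTree.forestHom_singleton_node hg.1, map_add, map_add, map_smul, map_smul, hd, smul_zero,
      add_zero]

end AbstractModel

-- Chen's identity in terms of the cutting operators

namespace PlanarRoughPath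
variable {n : ℕ} {γ : ℝ}

theorem isForestCharacter (X : PlanarRoughPath n γ) (s t : ℝ) :
    VTree.IsForestCharacter (X.X s t) :=
  ⟨X.map_one s t, X.map_shuffle s t⟩

theorem X_forestHom (X : PlanarRoughPath n γ) (s u t : ℝ) (x : OF n) :
    X.X u t (VTree.forestHom (X.X s u) x) = X.X s t x := by
  refine finsupp_hom_ext (f := X.X u t ∘ₗ VTree.forestHom (X.X s u)) (fun w => ?_) x
  rw [LinearMap.comp_apply, VTree.forestHom_single, ← X.chen s u t, mkwCoproduct_single]
  simp only [map_list_sum, List.map_map]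
  congr 1
  refine List.map_congr_left fun p _ => ?_
  simp only [Function.comp_apply, map_smul, TensorProduct.map_tmul, LinearMap.mul'_apply,
    smul_eq_mul, (X.isForestCharacter s u).listSum_shuffleAll]

/-- Chen's identity at three equal times makes `X_ss` idempotent for convolution. -/
theorem X_self (X : PlanarRoughPath n γ) (s : ℝ) : X.X s s = VTree.counit n :=
  VTree.eq_counit_of_comp_forestHom_eq (X.map_one s s)
    (LinearMap.ext fun x => X.X_forestHom s s s x)

theorem Gamma_phiLin (X : PlanarRoughPath n γ) (s t : ℝ) (x : VTree n →₀ ℝ) :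
    X.Gamma s t (phiLin n x) = phiLin n (VTree.treeHom (X.X t s) x) :=
  gammaOf_comp_phiInvBMinus (X.isForestCharacter t s) x

theorem Gamma_mem (X : PlanarRoughPath n γ) (s t : ℝ) : X.Gamma s t ∈ structureGroup n :=
  ⟨_, (X.isForestCharacter t s).isCharacter, rfl⟩

theorem Gamma_self (X : PlanarRoughPath n γ) (s : ℝ) : X.Gamma s s = LinearMap.id := by
  refine LinearMap.ext fun v => ?_
  obtain ⟨x, rfl⟩ := (phiLin n).surjective v
  rw [Gamma_phiLin, X_self, VTree.treeHom_counit, LinearMap.id_apply]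

/-- Since `Γ_st` is built from `X_ts`, the composition runs through `X_tu` and then `X_us`, which
Chen's identity combines into `X_ts`. -/
theorem Gamma_comp (X : PlanarRoughPath n γ) (s u t : ℝ) :
    X.Gamma s u ∘ₗ X.Gamma u t = X.Gamma s t := by
  refine LinearMap.ext fun v => ?_
  obtain ⟨x, rfl⟩ := (phiLin n).surjective v
  have h : X.X u s ∘ₗ VTree.forestHom (X.X t u) = X.X t s :=
    LinearMap.ext fun x => X.X_forestHom t u s x
  rw [LinearMap.comp_apply, Gamma_phiLin, Gamma_phiLin, Gamma_phiLin, VTree.treeHom_treeHom, h]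

/-- Maps `R s` with `R t = R s ∘ Γ` that send the empty forest to the kernel of `d` give a model. -/
theorem isModel_modelMap {D : Type*} [AddCommGroup D] [Module ℝ D] [TopologicalSpace D]
    [IsTopologicalAddGroup D] [ContinuousSMul ℝ D] (X : PlanarRoughPath n γ) {α : Fin n → ℝ}
    (hα : ∀ i, 0 < α i) (R : ℝ → OF n →ₗ[ℝ] D) (d : D →ₗ[ℝ] D)
    (hR : ∀ s t x, R t x = R s (VTree.forestHom (X.X t s) x))
    (hd : ∀ s, d (R s (Finsupp.single [] 1)) = 0) :
    IsModel (indexSet α) (homogeneous α) (structureGroup n) (fun s => modelMap (R s) d)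
      X.Gamma where
  mem := X.Gamma_mem
  self := X.Gamma_self
  comp := X.Gamma_comp
  continuous s a _ := by
    -- Each component has finite dimension, so linearity alone gives continuity.
    have := finiteDimensional_homogeneous hα a
    exact LinearMap.continuous_of_finiteDimensional (modelMap (R s) d ∘ₗ (homogeneous α a).subtype)
  translate s t := modelMap_comp_gammaOf _ _ d (X.isForestCharacter t s) (hR s t) (hd s)

/-! ### Continuity of the components of the path -/

open Filter Topology

theorem tendsto_single (hγ : 0 < γ) (X : PlanarRoughPath n γ) (s : ℝ) (w : List (VTree n)) :
    Tendsto (fun t => X.X s t (Finsupp.single w 1)) (𝓝 s)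
      (𝓝 (VTree.counit n (Finsupp.single w 1))) := by
  by_cases hw : w = []
  · subst hw
    simp [X.map_one]
  · rw [VTree.counit_single_of_ne_nil hw]
    -- The interval of radius `|s| + 1` about `0` contains every `t` within distance `1` of `s`.
    obtain ⟨C, hC⟩ := X.bound w (|s| + 1)
    have hp : 0 < γ * (VTree.sizeList w : ℝ) :=
      mul_pos hγ (by exact_mod_cast VTree.sizeList_pos hw)
    have hlim : Tendsto (fun t => C * |t - s| ^ (γ * (VTree.sizeList w : ℝ))) (𝓝 s) (𝓝 0) := by
      have hc : ContinuousAt (fun t => C * |t - s| ^ (γ * (VTree.sizeList w : ℝ))) s :=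
        continuousAt_const.mul (((continuousAt_id.sub continuousAt_const).abs).rpow_const
          (Or.inr hp.le))
      simpa [ContinuousAt, Real.zero_rpow hp.ne'] using hc
    refine squeeze_zero_norm' ?_ hlim
    filter_upwards [Metric.ball_mem_nhds s one_pos] with t ht
    rw [Metric.mem_ball, Real.dist_eq] at ht
    by_cases hst : s = t
    · subst hst
      rw [X_self, VTree.counit_single_of_ne_nil hw]
      simp [Real.zero_rpow hp.ne']
    · have h1 := abs_lt.1 ht
      have h2 := abs_le.1 (le_refl |s|)
      have h := hC s ⟨by linarith, by linarith⟩ t ⟨by linarith, by linarith⟩ hst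
      have hpos : 0 < |t - s| ^ (γ * (VTree.sizeList w : ℝ)) :=
        Real.rpow_pos_of_pos (abs_pos.2 (sub_ne_zero.2 (Ne.symm hst))) _
      rwa [div_le_iff₀ hpos] at h

theorem tendsto_X (hγ : 0 < γ) (X : PlanarRoughPath n γ) (s : ℝ) (x : OF n) :
    Tendsto (fun t => X.X s t x) (𝓝 s) (𝓝 (VTree.counit n x)) := by
  induction x using Finsupp.induction_linear with
  | zero => simp
  | add x y hx hy => simpa using hx.add hy
  | single w r =>
    have e : Finsupp.single w r = r • Finsupp.single w (1 : ℝ) := by simp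
    rw [e]
    simpa only [map_smul] using (X.tendsto_single hγ s w).const_smul r

/-- By Chen's identity `X_st x = X_ut (forestHom X_su x)`. As `t → u` this tends to the counit of
`forestHom X_su x`, which is `X_su x`; continuity on the diagonal thus spreads to all times. -/
theorem continuous_X (hγ : 0 < γ) (X : PlanarRoughPath n γ) (s : ℝ) (x : OF n) :
    Continuous fun t => X.X s t x := by
  rw [continuous_iff_continuousAt]
  intro u
  have h := X.tendsto_X hγ u (VTree.forestHom (X.X s u) x)
  simp only [X_forestHom] at h
  rwa [← LinearMap.comp_apply, VTree.counit_comp_forestHom] at h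

/-! ### The model with values in distributions -/

open MeasureTheory

theorem integrable_X_mul (hγ : 0 < γ) (X : PlanarRoughPath n γ) (s : ℝ) (x : OF n)
    (f : 𝓓((⊤ : TopologicalSpace.Opens ℝ), ℝ)) : Integrable fun t => X.X s t x * f t :=
  ((X.continuous_X hγ s x).mul f.continuous).integrable_of_hasCompactSupport
    f.hasCompactSupport.mul_left

/-- The function `t ↦ ⟨X_st, x⟩` as a distribution. -/
noncomputable def toDistribution (X : PlanarRoughPath n γ) (s : ℝ) (x : OF n) :
    LineDistribution :=
  ContinuousLinearMap.toUniformConvergenceCLM (RingHom.id ℝ) ℝ _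
    (TestFunction.integralAgainstBilinCLM (ContinuousLinearMap.mul ℝ ℝ).flip volume
      fun t => X.X s t x)

/-- Continuity of the path component supplies the local integrability needed to identify the pairing
with an integral. -/
theorem toDistribution_apply (hγ : 0 < γ) (X : PlanarRoughPath n γ) (s : ℝ) (x : OF n)
    (f : 𝓓((⊤ : TopologicalSpace.Opens ℝ), ℝ)) :
    X.toDistribution s x f = ∫ t, X.X s t x * f t :=
  TestFunction.integralAgainstBilinCLM_eq_integral
    ((X.continuous_X hγ s x).locallyIntegrable.locallyIntegrableOn _)

/-- The map `x ↦ (t ↦ ⟨X_st, x⟩)` from forests to distributions. -/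
noncomputable def distributionMap (hγ : 0 < γ) (X : PlanarRoughPath n γ) (s : ℝ) :
    OF n →ₗ[ℝ] LineDistribution where
  toFun := X.toDistribution s
  map_add' x y := by
    ext f
    change _ = X.toDistribution s x f + X.toDistribution s y f
    rw [toDistribution_apply hγ, toDistribution_apply hγ, toDistribution_apply hγ,
      ← integral_add (X.integrable_X_mul hγ s x f) (X.integrable_X_mul hγ s y f)]
    simp [add_mul]
  map_smul' r x := by
    ext f
    change _ = r * X.toDistribution s x f
    rw [toDistribution_apply hγ, toDistribution_apply hγ, ← integral_const_mul]
    simp [mul_assoc]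

/-- The distributional derivative on the line as a linear map. -/
noncomputable def distributionDeriv : LineDistribution →ₗ[ℝ] LineDistribution :=
  (Distribution.lineDerivCLM (1 : ℝ)).toLinearMap

theorem integral_lineDerivCLM (f : 𝓓((⊤ : TopologicalSpace.Opens ℝ), ℝ)) :
    ∫ t, (TestFunction.lineDerivCLM ℝ (1 : ℝ) f : 𝓓((⊤ : TopologicalSpace.Opens ℝ), ℝ)) t = 0 := by
  set f' : 𝓓((⊤ : TopologicalSpace.Opens ℝ), ℝ) := TestFunction.lineDerivCLM ℝ (1 : ℝ) f
  refine integral_eq_zero_of_hasDerivAt_of_integrable (f := f) (fun t => ?_)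
    (f'.continuous.integrable_of_hasCompactSupport f'.hasCompactSupport)
    (f.continuous.integrable_of_hasCompactSupport f.hasCompactSupport)
  have h : DifferentiableAt ℝ f t := (f.contDiff.differentiable (by simp)).differentiableAt
  have e : f' t = deriv f t := by
    rw [TestFunction.lineDerivCLM_apply_of_le le_top, h.lineDeriv_eq_fderiv]
    simp
  rw [e]
  exact h.hasDerivAt

/-- Every basis tree falls under exactly one of the two relations, and the second refers back only
to trees covered by the first. -/
theorem definesPi_iff (hγ : 0 < γ) (X : PlanarRoughPath n γ)
    (Pi : ℝ → PB n →ₗ[ℝ] LineDistribution) :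
    X.DefinesPi Pi ↔ Pi = fun s => modelMap (X.distributionMap hγ s) distributionDeriv := by
  constructor
  · intro h
    funext s
    refine (eq_modelMap_iff _ _ _).2 ⟨fun w => ?_, fun τ hτ => h.decorated s τ hτ⟩
    ext f
    exact (h.plain s w f).2.trans (X.toDistribution_apply hγ s _ f).symm
  · rintro rfl
    have h := fun s => (eq_modelMap_iff (X.distributionMap hγ s) distributionDeriv _).1 rfl
    refine ⟨fun s w f => ⟨X.integrable_X_mul hγ s _ f, ?_⟩, fun s τ hτ => (h s).2 τ hτ⟩
    simp only [(h s).1 w]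
    exact X.toDistribution_apply hγ s _ f

theorem isModel_distributionMap (hγ : 0 < γ) (X : PlanarRoughPath n γ) {α : Fin n → ℝ}
    (hα : ∀ i, 0 < α i) :
    IsModel (indexSet α) (homogeneous α) (structureGroup n)
      (fun s => modelMap (X.distributionMap hγ s) distributionDeriv) X.Gamma := by
  refine X.isModel_modelMap hα _ _ (fun s t x => ?_) fun s => ?_
  · ext f
    refine (X.toDistribution_apply hγ t _ f).trans
      (Eq.trans ?_ (X.toDistribution_apply hγ s _ f).symm)
    simp only [X_forestHom]
  · ext f
    -- The derivative of the constant distribution `1`, tested against `f`, is minus the integral of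
    -- `f'`.
    change -(X.toDistribution s (Finsupp.single [] 1) _) = 0
    rw [toDistribution_apply hγ]
    simp only [X.map_one, one_mul]
    rw [neg_eq_zero]
    exact integral_lineDerivCLM f

/-! ### The model with values in tempered distributions -/

theorem HasPolynomialGrowth.exists_bound {X : PlanarRoughPath n γ} (h : X.HasPolynomialGrowth)
    (s : ℝ) (x : OF n) : ∃ (C : ℝ) (N : ℕ), ∀ t, |X.X s t x| ≤ C * (1 + |t|) ^ N := by
  induction x using Finsupp.induction_linear with
  | zero => exact ⟨0, 0, by simp⟩
  | add x y hx hy =>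
    obtain ⟨C, N, hx⟩ := hx
    obtain ⟨C', N', hy⟩ := hy
    refine ⟨|C| + |C'|, max N N', fun t => ?_⟩
    have h1 : (1 : ℝ) ≤ 1 + |t| := by simp
    rw [map_add, add_mul]
    refine (abs_add_le _ _).trans (add_le_add ((hx t).trans ?_) ((hy t).trans ?_))
    · exact mul_le_mul (le_abs_self C) (pow_le_pow_right₀ h1 (le_max_left _ _)) (by positivity)
        (abs_nonneg C)
    · exact mul_le_mul (le_abs_self C') (pow_le_pow_right₀ h1 (le_max_right _ _)) (by positivity)
        (abs_nonneg C')
  | single w r =>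
    obtain ⟨C, N, hC⟩ := h s w
    refine ⟨|r| * C, N, fun t => ?_⟩
    have e : Finsupp.single w r = r • Finsupp.single w (1 : ℝ) := by simp
    rw [e, map_smul, smul_eq_mul, abs_mul, mul_assoc]
    exact mul_le_mul_of_nonneg_left (hC t) (abs_nonneg r)

/-- The Schwartz seminorms up to order `N + k` without derivatives absorb the growth `(1 + |t|)^N`
and leave the integrable weight `(1 + |t|)^(-k)`. The bound is uniform in `f`, so it yields both
integrability and continuity of the pairing. -/
theorem exists_schwartz_bound {p : ℝ → ℝ} (h : ∃ (C : ℝ) (N : ℕ), ∀ t, |p t| ≤ C * (1 + |t|) ^ N) :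
    ∃ (C : ℝ) (m : ℕ) (k : ℕ), 0 ≤ C ∧ Integrable (fun t : ℝ => (1 + ‖t‖) ^ (-(k : ℝ))) ∧
      ∀ (f : 𝓢(ℝ, ℂ)) (t : ℝ), ‖(p t : ℂ) * f t‖ ≤
        C * (Finset.Iic (m, 0)).sup (schwartzSeminormFamily ℂ ℝ ℂ) f *
          (1 + ‖t‖) ^ (-(k : ℝ)) := by
  obtain ⟨C, N, hC⟩ := h
  obtain ⟨k, hk⟩ := Measure.HasTemperateGrowth.exists_integrable (μ := (volume : Measure ℝ))
  -- At `t = 0` the growth bound reads `|p 0| ≤ C`.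
  have hC0 : 0 ≤ C := by simpa using (abs_nonneg _).trans (hC 0)
  refine ⟨C * 2 ^ (N + k), N + k, k, by positivity, hk, fun f t => ?_⟩
  have h1 := SchwartzMap.one_add_le_sup_seminorm_apply (𝕜 := ℂ) (m := (N + k, 0)) (k := N + k)
    (n := 0) le_rfl le_rfl f t
  rw [norm_iteratedFDeriv_zero] at h1
  have hpos : (0 : ℝ) < 1 + ‖t‖ := by positivity
  rw [Real.rpow_neg hpos.le, Real.rpow_natCast, ← div_eq_mul_inv, le_div_iff₀ (by positivity),
    norm_mul, Complex.norm_real, Real.norm_eq_abs]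
  calc |p t| * ‖f t‖ * (1 + ‖t‖) ^ k
      ≤ C * (1 + ‖t‖) ^ N * ‖f t‖ * (1 + ‖t‖) ^ k := by
        gcongr
        exact hC t
    _ = C * ((1 + ‖t‖) ^ (N + k) * ‖f t‖) := by ring
    _ ≤ C * (2 ^ (N + k) * (Finset.Iic (N + k, 0)).sup (schwartzSeminormFamily ℂ ℝ ℂ) f) :=
        mul_le_mul_of_nonneg_left h1 hC0
    _ = _ := by ring

theorem integrable_mul_schwartz {p : ℝ → ℝ} (hp : Continuous p)
    (h : ∃ (C : ℝ) (N : ℕ), ∀ t, |p t| ≤ C * (1 + |t|) ^ N) (f : 𝓢(ℝ, ℂ)) :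
    Integrable fun t => (p t : ℂ) * f t := by
  obtain ⟨C, m, k, -, hk, hb⟩ := exists_schwartz_bound h
  exact (hk.const_mul _).mono' (by fun_prop) (Filter.Eventually.of_forall fun t => hb f t)

/-- Integration against a continuous function of polynomial growth. -/
noncomputable def schwartzIntegral {p : ℝ → ℝ} (hp : Continuous p)
    (h : ∃ (C : ℝ) (N : ℕ), ∀ t, |p t| ≤ C * (1 + |t|) ^ N) : 𝓢(ℝ, ℂ) →L[ℂ] ℂ :=
  SchwartzMap.mkCLMtoNormedSpace (𝕜 := ℂ) (fun f => ∫ t, (p t : ℂ) * f t)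
    (fun f g => by
      rw [← integral_add (integrable_mul_schwartz hp h f) (integrable_mul_schwartz hp h g)]
      simp [mul_add])
    (fun a f => by
      rw [RingHom.id_apply, smul_eq_mul, ← integral_const_mul]
      simp [mul_left_comm])
    (by
      obtain ⟨C, m, k, hC, hk, hb⟩ := exists_schwartz_bound h
      refine ⟨Finset.Iic (m, 0), C * ∫ t : ℝ, (1 + ‖t‖) ^ (-(k : ℝ)), by positivity, fun f => ?_⟩
      refine (norm_integral_le_of_norm_le (hk.const_mul _)
        (Filter.Eventually.of_forall fun t => hb f t)).trans_eq ?_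
      rw [integral_const_mul]
      ring)

/-- The function `t ↦ ⟨X_st, x⟩` as a tempered distribution, linearly in `x`. -/
noncomputable def temperedMap (hγ : 0 < γ) {X : PlanarRoughPath n γ} (h : X.HasPolynomialGrowth)
    (s : ℝ) : OF n →ₗ[ℝ] 𝓢'(ℝ, ℂ) where
  toFun x := ContinuousLinearMap.toPointwiseConvergenceCLM _ _ _ _
    (schwartzIntegral (X.continuous_X hγ s x) (h.exists_bound s x))
  map_add' x y := by
    ext f
    change ∫ t, (X.X s t (x + y) : ℂ) * f t =
      (∫ t, (X.X s t x : ℂ) * f t) + ∫ t, (X.X s t y : ℂ) * f t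
    rw [← integral_add (integrable_mul_schwartz (X.continuous_X hγ s x) (h.exists_bound s x) f)
      (integrable_mul_schwartz (X.continuous_X hγ s y) (h.exists_bound s y) f)]
    simp [add_mul]
  map_smul' r x := by
    ext f
    change ∫ t, (X.X s t (r • x) : ℂ) * f t = r • ∫ t, (X.X s t x : ℂ) * f t
    rw [← integral_smul]
    simp [mul_assoc]

theorem temperedMap_apply (hγ : 0 < γ) {X : PlanarRoughPath n γ} (h : X.HasPolynomialGrowth)
    (s : ℝ) (x : OF n) (f : 𝓢(ℝ, ℂ)) :
    temperedMap hγ h s x f = ∫ t, (X.X s t x : ℂ) * f t := rfl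

/-- The derivative of tempered distributions on the line as a real linear map. -/
noncomputable def temperedDeriv : 𝓢'(ℝ, ℂ) →ₗ[ℝ] 𝓢'(ℝ, ℂ) :=
  (TemperedDistribution.derivCLM ℂ).toLinearMap.restrictScalars ℝ

theorem definesTemperedPi_iff (hγ : 0 < γ) {X : PlanarRoughPath n γ} (h : X.HasPolynomialGrowth)
    (Pi : ℝ → PB n →ₗ[ℝ] 𝓢'(ℝ, ℂ)) :
    X.DefinesTemperedPi Pi ↔ Pi = fun s => modelMap (temperedMap hγ h s) temperedDeriv := by
  constructor
  · intro hPi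
    funext s
    refine (eq_modelMap_iff _ _ _).2 ⟨fun w => ?_, fun τ hτ => hPi.decorated s τ hτ⟩
    ext f
    exact (hPi.plain s w f).2
  · rintro rfl
    have hm := fun s => (eq_modelMap_iff (temperedMap hγ h s) temperedDeriv _).1 rfl
    refine ⟨fun s w f => ⟨integrable_mul_schwartz (X.continuous_X hγ s _) (h.exists_bound s _) f,
      ?_⟩, fun s τ hτ => (hm s).2 τ hτ⟩
    simp only [(hm s).1 w]
    rfl

theorem integral_derivCLM (f : 𝓢(ℝ, ℂ)) : ∫ t, SchwartzMap.derivCLM ℂ ℂ f t = 0 :=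
  integral_eq_zero_of_hasDerivAt_of_integrable (f := f) (fun t => f.hasDerivAt t)
    (SchwartzMap.derivCLM ℂ ℂ f).integrable f.integrable

theorem isModel_temperedMap (hγ : 0 < γ) {X : PlanarRoughPath n γ} (h : X.HasPolynomialGrowth)
    {α : Fin n → ℝ} (hα : ∀ i, 0 < α i) :
    IsModel (indexSet α) (homogeneous α) (structureGroup n)
      (fun s => modelMap (temperedMap hγ h s) temperedDeriv) X.Gamma := by
  -- In the topology of pointwise convergence, scalar multiplication is continuous because finite
  -- sets of test functions are bounded; this is used for continuity on the finite-dimensional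
  -- components.
  have : ContinuousSMul ℂ 𝓢'(ℝ, ℂ) :=
    UniformConvergenceCLM.continuousSMul _ _ _ fun _ hS => Set.Finite.isVonNBounded hS
  have : ContinuousSMul ℝ 𝓢'(ℝ, ℂ) := IsScalarTower.continuousSMul ℂ
  refine X.isModel_modelMap hα _ _ (fun s t x => ?_) fun s => ?_
  · ext f
    rw [temperedMap_apply, temperedMap_apply]
    simp only [X_forestHom]
  · ext f
    -- As before, the derivative of the constant `1` pairs with `f` as the integral of `-f'`.
    change temperedMap hγ h s (Finsupp.single [] 1) (-SchwartzMap.derivCLM ℂ ℂ f) = 0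
    rw [map_neg, temperedMap_apply]
    simp only [X.map_one, Complex.ofReal_one, one_mul]
    rw [integral_derivCLM, neg_zero]

end PlanarRoughPath

-- The theorem

theorem mainTheorem1 (n : ℕ) (γ : ℝ) (hγ₀ : 0 < γ) (hγ₁ : γ ≤ 1)
    (α : Fin n → ℝ) (hα : ∀ i, 0 < α i ∧ α i ≤ 1)
    (X : PlanarRoughPath n γ) (htime : X.IsTimeAugmented) (hint : X.EdgesAreIntegration) :
    (IsPreRegularityStructure (indexSet α) (homogeneous α)
        (Finsupp.single PBTree.bullet 1) (structureGroup n) ∧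
      (IsRegularityStructure (indexSet α) (homogeneous α)
        (Finsupp.single PBTree.bullet 1) (structureGroup n) ↔
          ∀ k : Fin n → ℕ, ∑ i, (k i : ℝ) * α i ≠ 1)) ∧
    ((∃! Pi : ℝ → PB n →ₗ[ℝ] LineDistribution, X.DefinesPi Pi) ∧
      ∀ Pi : ℝ → PB n →ₗ[ℝ] LineDistribution, X.DefinesPi Pi →
        IsModel (indexSet α) (homogeneous α) (structureGroup n) Pi X.Gamma) ∧
    (X.HasPolynomialGrowth →
      (∃! Pi : ℝ → PB n →ₗ[ℝ] 𝓢'(ℝ, ℂ), X.DefinesTemperedPi Pi) ∧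
      ∀ Pi : ℝ → PB n →ₗ[ℝ] 𝓢'(ℝ, ℂ), X.DefinesTemperedPi Pi →
        IsModel (indexSet α) (homogeneous α) (structureGroup n) Pi X.Gamma) := by
  have hpos : ∀ i, 0 < α i := fun i => (hα i).1
  refine ⟨⟨isPreRegularityStructure_PB hpos, isRegularityStructure_PB_iff hpos⟩, ⟨?_, ?_⟩,
    fun h => ⟨?_, ?_⟩⟩
  · simp only [X.definesPi_iff hγ₀]
    exact existsUnique_eq
  · simp only [X.definesPi_iff hγ₀]
    rintro Pi rfl
    exact X.isModel_distributionMap hγ₀ hpos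
  · simp only [PlanarRoughPath.definesTemperedPi_iff hγ₀ h]
    exact existsUnique_eq
  · simp only [PlanarRoughPath.definesTemperedPi_iff hγ₀ h]
    rintro Pi rfl
    exact PlanarRoughPath.isModel_temperedMap hγ₀ h hpos
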